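/- Let $r,s\ge 0$ be integers, let $P=[0,r]\times[0,s]$ (where $[0,n]=\{0,1,\dots,n\}$) with the componentwise order, and let $\widehat P$ be $P$ with a global minimum $\hat 0$ and a global maximum $\hat 1$ adjoined. Let $\mathbb K$ be a field. For $v\in P$ the birational toggle $T_v$ replaces the label $f(v)$ of a labeling $f$ of $\widehat P$ by $$\frac{1}{f(v)}\cdot\frac{\sum_{w\lessdot v}f(w)}{\sum_{z\gtrdot v}1/f(z)}$$ (sums over $w,z\in\widehat P$) and keeps all other labels. Birational rowmotion is $\rho_B=T_{v_1}T_{v_2}\cdots T_{v_N}$ for any linear extension $v_1,\dots,v_N$ of $P$ (the toggle at $v_N$ acts first); its inverse is $T_{v_N}\cdots T_{v_2}T_{v_1}$. For $n\in\mathbb Z$ let $\rho_B^n(i,j)\in\mathbb K(x_{u,v}:(u,v)\in P)$ be the label at $(i,j)$ after applying $\rho_B^n$ to the generic labeling, which has the indeterminate $x_{u,v}$ at $(u,v)\in P$ and the label $1$ at $\hat 0$ and $\hat 1$. For $(i,j)\in P$ let $A_{ij}=\frac{1}{x_{ij}}\sum_{z\lessdot(i,j)}x_z$, the sum being over $z\in\widehat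 P$ with $x_{\hat 0}=1$. Thus $A_{ij}=(x_{i,j-1}+x_{i-1,j})/x_{ij}$ for $i,j\ge1$, $A_{i0}=x_{i-1,0}/x_{i0}$ for $i\ge 1$, $A_{0j}=x_{0,j-1}/x_{0j}$ for $j\ge 1$, and $A_{00}=1/x_{00}$. For integers $t,m,n\ge 0$ with $t\le\min\{r-m,s-n\}+1$ let $$H^t_{(m,n)}=\{(u,v)\in P: u\ge m,\ v\ge n,\ m+n+t-1\le u+v\le r+s-t+1\}.$$ A lattice path is a finite sequence of points in which each step is $(1,0)$ or $(0,1)$. Let $S_t(m,n)$ be the set of families $\{L_1,\dots,L_t\}$ of $t$ lattice paths in $H^t_{(m,n)}$, no two of which share a vertex, from the set of starting points $\{(m+t-\ell,\,n+\ell-1):1\le\ell\le t\}$ to the set of end points $\{(r-\ell+1,\,s-t+\ell):1\le\ell\le t\}$. Define the polynomial $$\varphi_t(m,n)=\sum_{\{L_1,\dots,L_t\}\in S_t(m,n)}\ \prod_{(u,v)\in H^t_{(m,n)}\setminus(L_1\cup\dots\cup L_t)}A_{uv}$$ in the variables $A_{uv}$, and let $\mu^{(a,b)}$ be the substitution $A_{u,v}\mapsto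 A_{u-a,v-b}$ on rational functions in these variables. Put $[\alpha]_+=\max\{\alpha,0\}$. **Theorem.** Let $k\in[0,r+s+1]$, $(i,j)\in P$ and $M=[k-i]_++[k-j]_+$. Then $\rho_B^{k+1}(i,j)$ is a well-defined nonzero rational function, and the following hold. (a) If $M\le k$, then, as rational functions in the $x_{u,v}$ and with a nonzero denominator, $$\rho_B^{k+1}(i,j)=\mu^{([k-j]_+,\,[k-i]_+)}\left(\frac{\varphi_{k-M}(i-k+M,\,j-k+M)}{\varphi_{k-M+1}(i-k+M,\,j-k+M)}\right).$$ (b) If $M\ge k$, then $$\rho_B^{k+1}(i,j)=\frac{1}{\rho_B^{k-i-j}(r-i,\,s-j)}.$$ -/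

import Mathlib

/-- `P` with a global maximum and a global minimum adjoined. -/
abbrev PHat (P : Type*) : Type _ := WithBot (WithTop P)

/-- The inclusion of `P` into `P` with a maximum and a minimum adjoined. -/
def toHat {P : Type*} (v : P) : PHat P := WithBot.some (WithTop.some v)

open Classical in
/-- The birational toggle at `v`, acting on labelings by elements of a field. -/
noncomputable def toggle {P : Type*} [PartialOrder P] [Fintype P] {F : Type*} [Field F]
    (v : P) (f : PHat P → F) : PHat P → F := fun y =>
  if y = toHat v then
    1 / f (toHat v) *
      ((∑ w ∈ Finset.univ.filter (fun w : PHat P => w ⋖ toHat v), f w) /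
        (∑ z ∈ Finset.univ.filter (fun z : PHat P => toHat v ⋖ z), 1 / f z))
  else f y

open Classical in
/-- Each toggle is an involution, at every labeling where it is defined. -/
theorem toggle_toggle {P : Type*} [PartialOrder P] [Fintype P] {F : Type*} [Field F]
    (v : P) (f : PHat P → F) (h : toggle v f (toHat v) ≠ 0) : toggle v (toggle v f) = f := by
  have hw : ∀ y, y ≠ toHat v → toggle v f y = f y := fun y hy => by simp [toggle, hy]
  funext y
  by_cases hy : y = toHat v
  · subst hy
    have h1 : toggle v (toggle v f) (toHat v) = 1 / toggle v f (toHat v) *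
        (f (toHat v) * toggle v f (toHat v)) := by
      conv_lhs => rw [toggle]
      rw [if_pos rfl]
      congr 1
      have hf : f (toHat v) ≠ 0 := by
        intro h0
        apply h
        simp [toggle, h0]
      have e1 : f (toHat v) * toggle v f (toHat v) =
          ((∑ w ∈ Finset.univ.filter (fun w : PHat P => w ⋖ toHat v), f w) /
            (∑ z ∈ Finset.univ.filter (fun z : PHat P => toHat v ⋖ z), 1 / f z)) := by
        simp only [toggle, if_true]
        field_simp
      rw [e1]
      congr 1
      · refine Finset.sum_congr rfl fun w hw' => hw w ?_
        rintro rfl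
        simp at hw'
      · refine Finset.sum_congr rfl fun w hw' => ?_
        rw [hw w ?_]
        rintro rfl
        simp at hw'
    rw [h1]
    field_simp
  · rw [toggle, if_neg hy, hw y hy]

/-- The list `v₁, v₂, …, vₙ` is a linear extension of `P`: every element of `P` is listed exactly
once, and no element is listed before a smaller one. -/
structure IsLinearExtension {P : Type*} [PartialOrder P] (l : List P) : Prop where
  nodup : l.Nodup
  mem_all : ∀ p : P, p ∈ l
  sorted : l.Pairwise (fun a b => ¬ b < a)

/-- Birational rowmotion `T_{v₁} T_{v₂} ⋯ T_{vₙ}`; the toggle at the last element `vₙ` of the list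
acts first. -/
noncomputable def rowmotion {P : Type*} [PartialOrder P] [Fintype P] {F : Type*} [Field F]
    (l : List P) (f : PHat P → F) : PHat P → F :=
  l.foldr (fun v g => toggle v g) f

/-- The inverse `T_{vₙ} ⋯ T_{v₂} T_{v₁}` of birational rowmotion (each toggle is an involution as
a rational map); the toggle at the first element `v₁` of the list acts first. -/
noncomputable def rowmotionInv {P : Type*} [PartialOrder P] [Fintype P] {F : Type*} [Field F]
    (l : List P) (f : PHat P → F) : PHat P → F :=
  l.foldl (fun g v => toggle v g) f

/-- The integer powers of birational rowmotion. -/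
noncomputable def rowmotionPow {P : Type*} [PartialOrder P] [Fintype P] {F : Type*} [Field F]
    (l : List P) : ℤ → (PHat P → F) → (PHat P → F)
  | Int.ofNat n => (rowmotion l)^[n]
  | Int.negSucc n => (rowmotionInv l)^[n + 1]

/-- The product of chains `[0,r] × [0,s]` with its componentwise order. -/
abbrev Rect (r s : ℕ) : Type := Fin (r + 1) × Fin (s + 1)

/-- The field `K(x_{u,v})` of rational functions in the indeterminates `x_{u,v}`, for `(u,v)` in
`[0,r] × [0,s]`. -/
abbrev RatFun (K : Type*) [Field K] (r s : ℕ) : Type _ :=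
  FractionRing (MvPolynomial (Rect r s) K)

/-- The generic labeling: the label `x_{u,v}` at `(u,v)`, and `1` at the adjoined minimum and
maximum. -/
noncomputable def genericLabeling (K : Type*) [Field K] (r s : ℕ) :
    PHat (Rect r s) → RatFun K r s
  | ⊥ => 1
  | WithBot.some ⊤ => 1
  | WithBot.some (WithTop.some p) =>
      algebraMap (MvPolynomial (Rect r s) K) (RatFun K r s) (MvPolynomial.X p)

/-- The rational function `ρ_B^n(i,j)`: the label at `p = (i,j)` after `n` applications of
birational rowmotion to the generic labeling. -/
noncomputable def rho (K : Type*) [Field K] {r s : ℕ} (l : List (Rect r s)) (n : ℤ)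
    (p : Rect r s) : RatFun K r s :=
  rowmotionPow l n (genericLabeling K r s) (toHat p)

open Classical in
/-- `A_{ij} = (∑_{z ⋖ (i,j)} x_z) / x_{ij}`, the sum being over the elements of `PHat P`
covered by `(i,j)`. -/
noncomputable def aElem (K : Type*) [Field K] {r s : ℕ} (p : Rect r s) : RatFun K r s :=
  (∑ z ∈ Finset.univ.filter (fun z : PHat (Rect r s) => z ⋖ toHat p), genericLabeling K r s z) /
    genericLabeling K r s (toHat p)

/-- The family `A_{u,v}` indexed by integer points; the value off `[0,r] × [0,s]` is a dummy. -/
noncomputable def aVal (K : Type*) [Field K] (r s : ℕ) (q : ℤ × ℤ) : RatFun K r s :=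
  if h : (0 ≤ q.1 ∧ q.1 ≤ r) ∧ (0 ≤ q.2 ∧ q.2 ≤ s) then
    aElem K (⟨q.1.toNat, by omega⟩, ⟨q.2.toNat, by omega⟩)
  else 0

/-- The rank-selected part of the principal order filter at `(m,n)` in `[0,r] × [0,s]`: the
elements `(u,v) ≥ (m,n)` with `m + n + k - 1 ≤ u + v ≤ r + s - k + 1`. -/
noncomputable def hexagon (r s k : ℕ) (m n : ℤ) : Finset (ℤ × ℤ) :=
  (Finset.Icc m (r : ℤ) ×ˢ Finset.Icc n (s : ℤ)).filter
    (fun p => m + n + k - 1 ≤ p.1 + p.2 ∧ p.1 + p.2 ≤ (r : ℤ) + s - k + 1)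

/-- The minimal elements `(m + k - ℓ, n + ℓ - 1)`, `1 ≤ ℓ ≤ k`, of the hexagon; here the index
is `a = ℓ - 1`. -/
def source {k : ℕ} (m n : ℤ) (a : Fin k) : ℤ × ℤ := (m + k - 1 - (a : ℕ), n + (a : ℕ))

/-- The maximal elements `(r - ℓ + 1, s - k + ℓ)`, `1 ≤ ℓ ≤ k`, of the hexagon; here the index
is `a = ℓ - 1`. -/
def sink {k : ℕ} (r s : ℕ) (a : Fin k) : ℤ × ℤ :=
  ((r : ℤ) - (a : ℕ), (s : ℤ) - k + 1 + (a : ℕ))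

/-- A lattice path: each step is `(1,0)` or `(0,1)`. -/
def IsLatticePath (L : List (ℤ × ℤ)) : Prop :=
  L.IsChain (fun v w => w = v + (1, 0) ∨ w = v + (0, 1))

/-- The families of non-intersecting lattice paths in the hexagon from the set of its `k` sources
to the set of its `k` sinks. A family is indexed by the sources, so that each family is listed
once; the sources may be matched with the sinks in any way. -/
def nilpFamilies (r s k : ℕ) (m n : ℤ) : Set (Fin k → List (ℤ × ℤ)) :=
  {L | (∀ a, IsLatticePath (L a)) ∧
    (∀ a, ∀ v ∈ L a, v ∈ hexagon r s k m n) ∧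
    (∀ a, (L a).head? = some (source m n a)) ∧
    (∃ σ : Equiv.Perm (Fin k), ∀ a, (L a).getLast? = some (sink r s (σ a))) ∧
    (∀ a b, a ≠ b → List.Disjoint (L a) (L b))}

theorem IsLatticePath.nodup {L : List (ℤ × ℤ)} (h : IsLatticePath L) : L.Nodup := by
  have h1 : L.IsChain (fun v w : ℤ × ℤ => v.1 + v.2 < w.1 + w.2) := by
    refine List.IsChain.imp ?_ h
    rintro v w (rfl | rfl) <;> simp [add_assoc]
  have : IsTrans (ℤ × ℤ) (fun v w : ℤ × ℤ => v.1 + v.2 < w.1 + w.2) :=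
    ⟨fun _ _ _ h1 h2 => lt_trans h1 h2⟩
  have h2 := List.isChain_iff_pairwise.mp h1
  refine List.Pairwise.imp ?_ h2
  rintro a b hab rfl
  exact lt_irrefl _ hab

theorem nilpFamilies_finite (r s k : ℕ) (m n : ℤ) : (nilpFamilies r s k m n).Finite := by
  have hfin : {l : List (ℤ × ℤ) | l.Nodup ∧ ∀ v ∈ l, v ∈ hexagon r s k m n}.Finite := by
    refine Set.Finite.subset
      (List.finite_length_le (hexagon r s k m n) (hexagon r s k m n).card |>.image
        (List.map Subtype.val)) ?_
    rintro l ⟨hnd, hl⟩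
    refine ⟨l.attach.map (fun v => ⟨v.1, hl v.1 v.2⟩), ?_, ?_⟩
    · have := Finset.card_le_card (s := l.toFinset) (t := hexagon r s k m n)
        (fun v hv => hl v (by simpa using hv))
      rw [List.toFinset_card_of_nodup hnd] at this
      simpa using this
    · rw [List.map_map]
      exact List.attach_map_subtype_val l
  refine Set.Finite.subset (Set.Finite.pi' (fun _ : Fin k => hfin)) ?_
  intro L hL a
  exact ⟨(hL.1 a).nodup, hL.2.1 a⟩

/-- The polynomial `φ_k(m,n)` in the formal variables `A_{u,v}`: the sum over all families of
non-intersecting lattice paths of the product of the variables at the elements of the hexagon that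
lie on no path of the family. -/
noncomputable def phi (r s k : ℕ) (m n : ℤ) : MvPolynomial (ℤ × ℤ) ℤ :=
  ∑ L ∈ (nilpFamilies_finite r s k m n).toFinset,
    ∏ p ∈ (hexagon r s k m n).filter (fun p => ∀ a, p ∉ L a), MvPolynomial.X p

/-- The index shift `A_{u,v} ↦ A_{u-a,v-b}`. -/
noncomputable def mu (a b : ℤ) : MvPolynomial (ℤ × ℤ) ℤ →ₐ[ℤ] MvPolynomial (ℤ × ℤ) ℤ :=
  MvPolynomial.rename (fun q => (q.1 - a, q.2 - b))

/-- The rational function in the `x_{u,v}` given by a polynomial in the variables `A_{u,v}`. -/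
noncomputable def evalA (K : Type*) [Field K] (r s : ℕ) :
    MvPolynomial (ℤ × ℤ) ℤ →ₐ[ℤ] RatFun K r s :=
  MvPolynomial.aeval (aVal K r s)

/-! ### Determinant identities of Plücker type. -/

section LinearAlgebra

variable {F : Type*} [Field F]

/-! Write y_k for the labeling after k rowmotions and w = 1/A. Let D_t(m,n;R,S) (`pathDet`) be the
determinant of path sums for t sources and t sinks in the rectangle with corners (m,n) and (R,S),
times the weights of the two corner staircases cut off by the sources and the sinks. By
Lindström–Gessel–Viennot (`sum_disjointPaths`), φ_t(m,n) is the product of all A over its rectangle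
times D_t (`ringHom_phi`). That product cancels in the quotient of (a), and μ only translates the
rectangle. So (a) says y_{k+1}(i,j) = D_t / D_{t+1} with t = k - M, on the rectangle with corners
([i-k]_+, [j-k]_+) and (r-[k-j]_+, s-[k-i]_+); this is `PathFormula`.

The proof is by induction on k and, for fixed k, downwards on i + j, using the local rule y_{k+1}(v)
· y_k(v) · Σ 1/y_{k+1}(z) = Σ y_k(u), with z covering v and u covered by v. The denominators of y_k
at the lower neighbours are the numerators of y_{k+1} at the upper neighbours, so both sums have the
same common denominator, and each is evaluated by one three-term determinant identity: an octahedron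
relation with fixed sinks when i and j are both large compared with k, one with fixed sources when
both are small, and Desnanot–Jacobi condensation in the mixed case. All three come from the Plücker
relation `det_three_term`, once the staircase weights are absorbed by sliding sources and sinks to
the sides of the rectangle. At the top corner (r,s) the second identity is replaced by a relation
between products of weights over rectangles.

For (b), the case k = i + j has t = 0 and the denominator is a single path sum, equal to the initial
label at (r-i, s-j) because w times the sum of the lower labels is the label. This reciprocity is
applied to the labeling after k - i - j rowmotions. Every toggle preserves algebraic independence of
the labels (`IsGeneric.toggle`), so no denominator vanishes and negative powers are true inverses.
-/

theorem sum_mul_det_succAbove_eq_zero {N : ℕ} (v : Fin (N + 1) → Fin N → F)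
    (L : (Fin N → F) →ₗ[F] F) :
    ∑ i : Fin (N + 1), (-1) ^ (i : ℕ) * L (v i) *
      Matrix.det (Matrix.of fun a : Fin N => v (i.succAbove a)) = 0 := by
  let M : Matrix (Fin (N + 1)) (Fin (N + 1)) F :=
    Matrix.of fun i => Fin.cons (L (v i)) (v i)
  have hM : M.det = 0 := by
    rw [← Matrix.exists_mulVec_eq_zero_iff]
    -- The column of values of `L` is a combination of the coordinate columns, with the values of
    -- `L` at the unit vectors as coefficients. Expanding the zero determinant along it gives the
    -- sum.
    refine ⟨Fin.cons (-1) fun j => L (Pi.single j 1), ?_, ?_⟩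
    · intro h
      simpa using congrFun h 0
    · funext i
      have := LinearMap.pi_apply_eq_sum_univ L (v i)
      simp only [Matrix.mulVec, dotProduct, Fin.sum_univ_succ, Fin.cons_zero, Fin.cons_succ, M,
        Matrix.of_apply, Pi.zero_apply]
      rw [this]
      have hs : ∀ x : Fin N, (fun j => if x = j then (1 : F) else 0) = Pi.single x 1 := fun x => by
        funext j; simp [Pi.single_apply, eq_comm]
      simp [hs]
  rw [Matrix.det_succ_column_zero] at hM
  exact hM

/-- The three-term relation for determinants with the common rows `B`. -/
theorem det_three_term {d : ℕ} (B : Fin d → Fin (d + 2) → F) (e x q p : Fin (d + 2) → F) :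
    Matrix.det (Matrix.of (Fin.cons x (Fin.cons q B : Fin (d + 1) → _) : Fin (d + 2) → _)) *
        Matrix.det (Matrix.of (Fin.cons e (Fin.snoc B p : Fin (d + 1) → _) : Fin (d + 2) → _)) +
      Matrix.det (Matrix.of (Fin.cons q (Fin.snoc B p : Fin (d + 1) → _) : Fin (d + 2) → _)) *
        Matrix.det (Matrix.of (Fin.cons e (Fin.cons x B : Fin (d + 1) → _) : Fin (d + 2) → _)) =
      Matrix.det (Matrix.of (Fin.cons x (Fin.snoc B p : Fin (d + 1) → _) : Fin (d + 2) → _)) *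
        Matrix.det (Matrix.of (Fin.cons e (Fin.cons q B : Fin (d + 1) → _) : Fin (d + 2) → _)) := by
  let D : (Fin (d + 2) → F) [⋀^Fin (d + 2)]→ₗ[F] F := Matrix.detRowAlternating
  -- This functional kills every row of `B`, so only the terms of `e`, `x` and `q` survive in the
  -- linear relation.
  let L : (Fin (d + 2) → F) →ₗ[F] F :=
    { toFun := fun y => D (Fin.cons y (Fin.snoc B p : Fin (d + 1) → _))
      map_add' := fun y z => D.toMultilinearMap.cons_add _ _ _
      map_smul' := fun c y => D.toMultilinearMap.cons_smul _ _ _ }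
  have hL : ∀ y, L y =
      Matrix.det (Matrix.of (Fin.cons y (Fin.snoc B p : Fin (d + 1) → _) : Fin (d + 2) → _)) :=
    fun y => rfl
  have hLB : ∀ a, L (B a) = 0 := fun a =>
    D.map_eq_zero_of_eq _ (i := 0) (j := a.castSucc.succ) (by simp) (Fin.succ_ne_zero _).symm
  have h := sum_mul_det_succAbove_eq_zero
    (Fin.cons e (Fin.cons x (Fin.cons q B : Fin (d + 1) → _) : Fin (d + 2) → _) :
      Fin (d + 3) → _) L
  simp only [Fin.sum_univ_succ, Fin.cons_zero, Fin.cons_succ, hLB] at h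
  have e0 : (fun a => (Fin.cons e (Fin.cons x (Fin.cons q B : Fin (d + 1) → _) : Fin (d + 2) → _) :
      Fin (d + 3) → Fin (d + 2) → F) ((0 : Fin (d + 3)).succAbove a)) =
      (Fin.cons x (Fin.cons q B : Fin (d + 1) → _) : Fin (d + 2) → _) := by
    funext a; simp
  have e1 : (fun a => (Fin.cons e (Fin.cons x (Fin.cons q B : Fin (d + 1) → _) : Fin (d + 2) → _) :
      Fin (d + 3) → Fin (d + 2) → F) ((Fin.succ 0 : Fin (d + 3)).succAbove a)) =
      (Fin.cons e (Fin.cons q B : Fin (d + 1) → _) : Fin (d + 2) → _) := by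
    funext a
    refine Fin.cases ?_ (fun a => ?_) a
    · simp
    · rw [Fin.succ_succAbove_succ]; simp
  have e2 : (fun a => (Fin.cons e (Fin.cons x (Fin.cons q B : Fin (d + 1) → _) : Fin (d + 2) → _) :
      Fin (d + 3) → Fin (d + 2) → F) ((Fin.succ (Fin.succ 0) : Fin (d + 3)).succAbove a)) =
      (Fin.cons e (Fin.cons x B : Fin (d + 1) → _) : Fin (d + 2) → _) := by
    funext a
    refine Fin.cases ?_ (fun a => ?_) a
    · rw [Fin.succ_succAbove_zero]; simp
    · rw [Fin.succ_succAbove_succ]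
      refine Fin.cases ?_ (fun a => ?_) a
      · simp
      · rw [Fin.succ_succAbove_succ]; simp
  rw [e0, e1, e2, hL, hL, hL] at h
  simp only [Fin.val_zero, pow_zero, Fin.val_succ, zero_add, pow_one, mul_zero, zero_mul,
    Finset.sum_const_zero] at h
  linear_combination h

theorem det_cons_snoc {d : ℕ} (B : Fin d → Fin (d + 2) → F) (a b : Fin (d + 2) → F) :
    Matrix.det (Matrix.of (Fin.cons a (Fin.snoc B b : Fin (d + 1) → _) : Fin (d + 2) → _)) =
      (-1) ^ d *
        Matrix.det (Matrix.of (Fin.cons a (Fin.cons b B : Fin (d + 1) → _) : Fin (d + 2) → _)) := by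
  let D : (Fin (d + 2) → F) [⋀^Fin (d + 2)]→ₗ[F] F := Matrix.detRowAlternating
  have h := (D.curryLeft a).map_perm (Fin.cons b B : Fin (d + 1) → _) (finRotate (d + 1))
  have h2 : (Fin.cons b B : Fin (d + 1) → Fin (d + 2) → F) ∘ finRotate (d + 1) = Fin.snoc B b :=
    (Fin.snoc_eq_cons_rotate B b).symm
  rw [h2, sign_finRotate] at h
  rw [Units.smul_def] at h
  push_cast at h
  rw [zsmul_eq_mul] at h
  push_cast at h
  exact h

theorem det_snoc {d : ℕ} (B : Fin d → Fin (d + 1) → F) (b : Fin (d + 1) → F) :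
    Matrix.det (Matrix.of (Fin.snoc B b : Fin (d + 1) → _)) =
      (-1) ^ d * Matrix.det (Matrix.of (Fin.cons b B : Fin (d + 1) → _)) := by
  let D : (Fin (d + 1) → F) [⋀^Fin (d + 1)]→ₗ[F] F := Matrix.detRowAlternating
  have h := D.map_perm (Fin.cons b B : Fin (d + 1) → _) (finRotate (d + 1))
  have h2 : (Fin.cons b B : Fin (d + 1) → Fin (d + 1) → F) ∘ finRotate (d + 1) = Fin.snoc B b :=
    (Fin.snoc_eq_cons_rotate B b).symm
  rw [h2, sign_finRotate] at h
  rw [Units.smul_def] at h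
  push_cast at h
  rw [zsmul_eq_mul] at h
  push_cast at h
  exact h

theorem det_cons_single_zero {d : ℕ} (X : Fin d → Fin (d + 1) → F) :
    Matrix.det (Matrix.of (Fin.cons (Pi.single 0 1) X : Fin (d + 1) → _)) =
      Matrix.det (Matrix.of fun a b : Fin d => X a b.succ) := by
  rw [Matrix.det_succ_row_zero, Finset.sum_eq_single 0]
  · simp only [Matrix.of_apply, Fin.cons_zero, Pi.single_eq_same, Fin.val_zero, pow_zero, one_mul]
    congr 1
  · intro b _ hb
    simp [hb]
  · simp

theorem det_snoc_single_last {d : ℕ} (X : Fin d → Fin (d + 1) → F) :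
    Matrix.det (Matrix.of (Fin.snoc X (Pi.single (Fin.last d) 1) : Fin (d + 1) → _)) =
      Matrix.det (Matrix.of fun a b : Fin d => X a b.castSucc) := by
  rw [Matrix.det_succ_row _ (Fin.last d), Finset.sum_eq_single (Fin.last d)]
  · simp only [Matrix.of_apply, Fin.snoc_last, Pi.single_eq_same, Fin.val_last, ← two_mul, pow_mul]
    simp only [even_two, Even.neg_pow, one_pow, one_mul]
    congr 1
    ext a b
    simp
  · intro b _ hb
    simp [hb]
  · simp

/-- The Desnanot–Jacobi identity. -/
theorem det_mul_det_interior {d : ℕ} (M : ℕ → ℕ → F) :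
    Matrix.det (Matrix.of fun a b : Fin (d + 2) => M a b) *
        Matrix.det (Matrix.of fun a b : Fin d => M (a + 1) (b + 1)) +
      Matrix.det (Matrix.of fun a b : Fin (d + 1) => M (a + 1) b) *
        Matrix.det (Matrix.of fun a b : Fin (d + 1) => M a (b + 1)) =
      Matrix.det (Matrix.of fun a b : Fin (d + 1) => M a b) *
        Matrix.det (Matrix.of fun a b : Fin (d + 1) => M (a + 1) (b + 1)) := by
  let row : ℕ → Fin (d + 2) → F := fun a b => M a b
  let B : Fin d → Fin (d + 2) → F := fun a => row (a + 1)
  -- A unit row deletes a column: `f` the first, `e` the last. The rest is the sign of moving a row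
  -- past `B`.
  let f : Fin (d + 2) → F := Pi.single 0 1
  let e : Fin (d + 2) → F := Pi.single (Fin.last _) 1
  have h := det_three_term B f (row 0) (row (d + 1)) e
  have hneg : ((-1 : F) ^ d) * (-1) ^ d = 1 := by
    rw [← mul_pow]; simp
  have s1 := det_cons_snoc B (row 0) (row (d + 1))
  have s2 := det_cons_snoc B f (row (d + 1))
  have c0 : (Fin.cons (row 0) B : Fin (d + 1) → Fin (d + 2) → F) = fun a : Fin (d + 1) => row (a : ℕ) := by
    funext a; refine Fin.cases ?_ (fun a => ?_) a <;> simp [B]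
  have c1 : (Fin.snoc B (row (d + 1)) : Fin (d + 1) → Fin (d + 2) → F) = fun a : Fin (d + 1) => row ((a : ℕ) + 1) := by
    funext a; refine Fin.lastCases ?_ (fun a => ?_) a <;> simp [B]
  have c2 : (Fin.cons (row 0) (Fin.snoc B (row (d + 1)) : Fin (d + 1) → Fin (d + 2) → F) :
      Fin (d + 2) → Fin (d + 2) → F) = fun a : Fin (d + 2) => row (a : ℕ) := by
    rw [c1]; funext a; refine Fin.cases ?_ (fun a => ?_) a <;> simp
  have k : ∀ b : Fin (d + 2) → F, (Fin.cons b (Fin.snoc B e : Fin (d + 1) → Fin (d + 2) → F) :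
      Fin (d + 2) → Fin (d + 2) → F) = Fin.snoc (Fin.cons b B : Fin (d + 1) → Fin (d + 2) → F) e :=
    fun b => Fin.cons_snoc_eq_snoc_cons b B e
  have s3 : Matrix.det (Matrix.of (Fin.snoc (fun a : Fin (d + 1) => row ((a : ℕ) + 1)) e :
      Fin (d + 2) → _)) = (-1) ^ d * Matrix.det (Matrix.of (Fin.cons (row (d + 1))
        (Fin.snoc B e : Fin (d + 1) → _) : Fin (d + 2) → _)) := by
    rw [k, det_snoc, det_snoc, ← c1, det_cons_snoc]
    ring
  have t0 : Matrix.det (Matrix.of (Fin.cons f (Fin.snoc B e : Fin (d + 1) → _) :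
      Fin (d + 2) → _)) = Matrix.det (Matrix.of fun a b : Fin d => M (a + 1) (b + 1)) := by
    rw [det_cons_single_zero]
    have : (fun a b : Fin (d + 1) => (Fin.snoc B e : Fin (d + 1) → Fin (d + 2) → F) a b.succ) =
        (Fin.snoc (fun a b => M (a + 1) (b + 1)) (Pi.single (Fin.last _) 1) :
          Fin (d + 1) → Fin (d + 1) → F) := by
      funext a b
      refine Fin.lastCases ?_ (fun a => ?_) a
      · simp only [Fin.snoc_last, e]
        rw [← Fin.succ_last]
        simp [Pi.single_apply]
      · simp [B, row]
    rw [this, det_snoc_single_last]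
    rfl
  rw [c2] at s1
  rw [c1, det_cons_single_zero] at s2
  rw [det_snoc_single_last] at s3
  rw [t0, k (row 0), c0, det_snoc_single_last, det_cons_single_zero] at h
  simp only [row, Fin.val_castSucc, Fin.val_succ] at s1 s2 s3 h
  rw [s1, s2, s3]
  linear_combination ((-1) ^ d) * h

end LinearAlgebra

/-! ### Row operations that slide points from an antidiagonal to a side. -/

section Staircase

variable {F : Type*} [Field F]

/-- The product of `c i a` over the pairs with `i + a + 2 ≤ t`. -/
def staircaseProd (t : ℕ) (c : ℕ → ℕ → F) : F :=
  ∏ i ∈ Finset.range t, ∏ a ∈ Finset.range t, if a + i + 2 ≤ t then c a i else 1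

theorem staircaseProd_swap (t : ℕ) (c : ℕ → ℕ → F) :
    staircaseProd t (fun i a => c a i) = staircaseProd t c := by
  rw [staircaseProd, Finset.prod_comm, staircaseProd]
  refine Finset.prod_congr rfl fun i _ => Finset.prod_congr rfl fun a _ => ?_
  rw [add_comm i a]

/-- One of the two summands in the recursion is the preceding row, so a row operation replaces each
row by the other summand at the cost of one factor `c`. Each cell of the staircase is used once. -/
theorem det_staircase_horizontal {t : ℕ} (g : ℕ → ℕ → Fin t → F) (c : ℕ → ℕ → F)
    (h : ∀ i a, i + a + 2 ≤ t → g i a = c i a • (g (i + 1) a + g i (a + 1))) :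
    Matrix.det (Matrix.of fun a : Fin t => g (t - 1 - a) 0) =
      staircaseProd t c * Matrix.det (Matrix.of fun a : Fin t => g (t - 1 - a) a) := by
  obtain _ | d := t
  · simp [staircaseProd]
  -- After `I` rounds, row `a` has moved `min I a` steps towards the antidiagonal.
  have key : ∀ I : ℕ, Matrix.det (Matrix.of fun a : Fin (d + 1) => g (d - a) 0) =
      (∏ i ∈ Finset.range I, ∏ a ∈ Finset.range (d + 1),
        if a + i + 2 ≤ d + 1 then c a i else 1) *
      Matrix.det (Matrix.of fun a : Fin (d + 1) => g (d - a) (min I a)) := by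
    intro I
    induction I with
    | zero => simp
    | succ i ih =>
      rw [ih, Finset.prod_range_succ, mul_assoc]
      congr 1
      let δ : Fin (d + 1) → F := fun a => if i + 1 ≤ (a : ℕ) then c (d - a) i else 1
      have hδ : ∏ a, δ a = ∏ a ∈ Finset.range (d + 1), if a + i + 2 ≤ d + 1 then c a i else 1 := by
        rw [Fin.prod_univ_eq_prod_range (fun a => if i + 1 ≤ a then c (d - a) i else 1) (d + 1),
          ← Finset.prod_range_reflect]
        refine Finset.prod_congr rfl fun a ha => ?_
        rw [Finset.mem_range] at ha
        have h1 : d - (d + 1 - 1 - a) = a := by omega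
        rw [h1]
        congr 1
        simp only [eq_iff_iff]
        omega
      rw [← hδ, ← Matrix.det_mul_column]
      refine Matrix.det_eq_of_forall_row_eq_smul_add_pred
        (fun a : Fin d => if i ≤ (a : ℕ) then c (d - (a + 1)) i else 0) ?_ ?_
      · intro j
        simp [δ]
      · intro a j
        have ha := a.2
        by_cases hi : i ≤ (a : ℕ)
        · have h1 := congrFun (h (d - (a + 1)) i (by omega)) j
          have h2 : d - ((a : ℕ) + 1) + 1 = d - a := by omega
          rw [h2] at h1
          simp only [Matrix.of_apply, Fin.val_succ, Fin.val_castSucc, δ, hi, if_true,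
            Nat.add_le_add_iff_right, min_eq_left hi, min_eq_left (le_trans hi (Nat.le_succ a)),
            min_eq_left (Nat.add_le_add_right hi 1)]
          rw [h1]
          simp only [Pi.smul_apply, Pi.add_apply, smul_eq_mul]
          ring
        · have h3 : min i ((a : ℕ) + 1) = a + 1 := by omega
          have h4 : min (i + 1) ((a : ℕ) + 1) = a + 1 := by omega
          simp [δ, hi, h3, h4]
  have h2 := key (d + 1)
  have h3 : ∀ a : Fin (d + 1), min (d + 1) (a : ℕ) = a := fun a => by omega
  simp only [h3] at h2
  exact h2

/-- Exchanging the two indices reduces this to the horizontal case with the rows in reverse order;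
the sign of the reversal occurs on both sides and cancels. -/
theorem det_staircase_vertical {t : ℕ} (g : ℕ → ℕ → Fin t → F) (c : ℕ → ℕ → F)
    (h : ∀ i a, i + a + 2 ≤ t → g i a = c i a • (g (i + 1) a + g i (a + 1))) :
    Matrix.det (Matrix.of fun a : Fin t => g 0 a) =
      staircaseProd t c * Matrix.det (Matrix.of fun a : Fin t => g (t - 1 - a) a) := by
  have h1 := det_staircase_horizontal (fun i a => g a i) (fun i a => c a i) (fun i a hia => by
    rw [h a i (by omega), add_comm (g (a + 1) i)])
  rw [staircaseProd_swap] at h1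
  have e1 := Matrix.det_permute Fin.revPerm (Matrix.of fun a : Fin t => g 0 a)
  have e2 := Matrix.det_permute Fin.revPerm (Matrix.of fun a : Fin t => g (t - 1 - a) a)
  have f1 : (Matrix.of fun a : Fin t => g 0 a).submatrix Fin.revPerm id =
      Matrix.of fun a : Fin t => g 0 (t - 1 - a) := by
    ext a b
    simp only [Matrix.submatrix_apply, Fin.revPerm_apply, Matrix.of_apply, Fin.val_rev, id]
    rw [show t - ((a : ℕ) + 1) = t - 1 - a by omega]
  have f2 : (Matrix.of fun a : Fin t => g (t - 1 - a) a).submatrix Fin.revPerm id =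
      Matrix.of fun a : Fin t => g a (t - 1 - a) := by
    ext a b
    simp only [Matrix.submatrix_apply, Fin.revPerm_apply, Matrix.of_apply, Fin.val_rev, id]
    rw [show t - ((a : ℕ) + 1) = t - 1 - a by omega, show t - 1 - (t - 1 - (a : ℕ)) = a by omega]
  rw [f1] at e1
  rw [f2] at e2
  rw [e1, e2] at h1
  have hs : ((Equiv.Perm.sign (Fin.revPerm : Equiv.Perm (Fin t)) : ℤ) : F) ≠ 0 := by
    rcases Int.units_eq_one_or (Equiv.Perm.sign (Fin.revPerm : Equiv.Perm (Fin t))) with h | h <;>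
      simp [h]
  refine mul_left_cancel₀ hs ?_
  rw [h1]
  ring

end Staircase

/-! ### Weighted counts of single lattice paths. -/

section PathSums

variable {F : Type*} [Field F]

/-- The sum, over the lattice paths from `(u, v)` to `(u + d, v + e)`, of the product of the
weights of the vertices. -/
def pathSum (w : ℤ → ℤ → F) : ℕ → ℕ → ℤ → ℤ → F
  | 0, 0, u, v => w u v
  | d + 1, 0, u, v => w u v * pathSum w d 0 (u + 1) v
  | 0, e + 1, u, v => w u v * pathSum w 0 e u (v + 1)
  | d + 1, e + 1, u, v => w u v * (pathSum w d (e + 1) (u + 1) v + pathSum w (d + 1) e u (v + 1))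

/-- The weighted count of the lattice paths from `(u, v)` to `(R, S)`. -/
def greens (w : ℤ → ℤ → F) (u v R S : ℤ) : F :=
  if u ≤ R ∧ v ≤ S then pathSum w (R - u).toNat (S - v).toNat u v else 0

theorem greens_of_not_le (w : ℤ → ℤ → F) {u v R S : ℤ} (h : ¬(u ≤ R ∧ v ≤ S)) :
    greens w u v R S = 0 := if_neg h

/-- The indicator accounts for the one-vertex path and makes the recursion valid at all integer
points, including those from which no path exists. -/
theorem greens_eq (w : ℤ → ℤ → F) (u v R S : ℤ) :
    greens w u v R S = w u v * (greens w (u + 1) v R S + greens w u (v + 1) R S +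
      if u = R ∧ v = S then 1 else 0) := by
  by_cases h : u ≤ R ∧ v ≤ S
  · have h3 : v ≤ S := h.2
    have h4 : u ≤ R := h.1
    obtain ⟨d, hd⟩ : ∃ d : ℕ, (R - u).toNat = d := ⟨_, rfl⟩
    obtain ⟨e, he⟩ : ∃ e : ℕ, (S - v).toNat = e := ⟨_, rfl⟩
    obtain _ | d := d <;> obtain _ | e := e
    · obtain rfl : u = R := by omega
      obtain rfl : v = S := by omega
      simp [greens, pathSum]
    · obtain rfl : u = R := by omega
      have h2 : (S - (v + 1)).toNat = e := by omega
      have h5 : ¬ v = S := by omega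
      have h6 : v + 1 ≤ S := by omega
      simp [greens, he, h2, h3, h5, h6, pathSum]
    · obtain rfl : v = S := by omega
      have h2 : (R - (u + 1)).toNat = d := by omega
      have h5 : ¬ u = R := by omega
      have h6 : u + 1 ≤ R := by omega
      simp [greens, hd, h2, h4, h5, h6, pathSum]
    · have h2 : (S - (v + 1)).toNat = e := by omega
      have h5 : ¬ v = S := by omega
      have h6 : v + 1 ≤ S := by omega
      have h2' : (R - (u + 1)).toNat = d := by omega
      have h6' : u + 1 ≤ R := by omega
      simp [greens, hd, he, h2, h3, h4, h5, h6, h2', h6', pathSum]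
  · rw [greens_of_not_le w h, greens_of_not_le w (by omega), greens_of_not_le w (by omega),
      if_neg (by omega)]
    simp

theorem greens_step (w : ℤ → ℤ → F) {u v R S : ℤ} (h : ¬(u = R ∧ v = S)) :
    greens w u v R S = w u v * (greens w (u + 1) v R S + greens w u (v + 1) R S) := by
  rw [greens_eq, if_neg h, add_zero]

theorem greens_self (w : ℤ → ℤ → F) (u v : ℤ) : greens w u v u v = w u v := by
  simp [greens, pathSum]

/-- The first-step recursion determines the path sums. -/
theorem eq_greens (w : ℤ → ℤ → F) (R S : ℤ) (H : ℤ → ℤ → F)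
    (h0 : ∀ u v, ¬(u ≤ R ∧ v ≤ S) → H u v = 0)
    (h1 : ∀ u v, u ≤ R → v ≤ S → H u v = w u v * (H (u + 1) v + H u (v + 1) +
      if u = R ∧ v = S then 1 else 0)) (u v : ℤ) : H u v = greens w u v R S := by
  by_cases h : u ≤ R ∧ v ≤ S
  · obtain ⟨N, hN⟩ : ∃ N : ℕ, (N : ℤ) = R - u + (S - v) := ⟨(R - u + (S - v)).toNat, by omega⟩
    induction N using Nat.strong_induction_on generalizing u v with
    | _ N ih =>
      have aux : ∀ u' v', u' + v' = u + v + 1 → H u' v' = greens w u' v' R S := by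
        intro u' v' huv
        by_cases h' : u' ≤ R ∧ v' ≤ S
        · exact ih (N - 1) (by omega) u' v' h' (by omega)
        · rw [h0 _ _ h', greens_of_not_le w h']
      rw [h1 u v h.1 h.2, greens_eq, aux (u + 1) v (by ring), aux u (v + 1) (by ring)]
  · rw [h0 _ _ h, greens_of_not_le w h]

/-- Splitting off the first step commutes with splitting off the last, so the right-hand side obeys
the first-step recursion, and `eq_greens` identifies it. The symmetries below are obtained in the
same way. -/
theorem greens_eq_last (w : ℤ → ℤ → F) (u v R S : ℤ) :
    greens w u v R S = w R S * (greens w u v (R - 1) S + greens w u v R (S - 1) +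
      if u = R ∧ v = S then 1 else 0) := by
  symm
  refine eq_greens w R S (fun u v => w R S * (greens w u v (R - 1) S + greens w u v R (S - 1) +
      if u = R ∧ v = S then 1 else 0)) ?_ ?_ u v
  · intro u v h
    rw [greens_of_not_le w (by omega), greens_of_not_le w (by omega), if_neg (by omega)]
    simp
  · intro u v hu hv
    rw [greens_eq w u v (R - 1) S, greens_eq w u v R (S - 1)]
    have e1 : (u = R - 1 ∧ v = S) ↔ (u + 1 = R ∧ v = S) := by omega
    have e2 : (u = R ∧ v = S - 1) ↔ (u = R ∧ v + 1 = S) := by omega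
    simp only [e1, e2]
    by_cases h : u = R ∧ v = S
    · obtain ⟨rfl, rfl⟩ := h
      have g1 := greens_of_not_le w (u := u + 1) (v := v) (R := u) (S := v - 1) (by omega)
      have g2 := greens_of_not_le w (u := u + 1) (v := v) (R := u - 1) (S := v) (by omega)
      have g3 := greens_of_not_le w (u := u) (v := v + 1) (R := u) (S := v - 1) (by omega)
      have g4 := greens_of_not_le w (u := u) (v := v + 1) (R := u - 1) (S := v) (by omega)
      simp [g1, g2, g3, g4]
    · rw [if_neg h]
      ring

theorem greens_step_last (w : ℤ → ℤ → F) {u v R S : ℤ} (h : ¬(u = R ∧ v = S)) :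
    greens w u v R S = w R S * (greens w u v (R - 1) S + greens w u v R (S - 1)) := by
  rw [greens_eq_last, if_neg h, add_zero]

theorem greens_swap (w : ℤ → ℤ → F) (u v R S : ℤ) :
    greens (fun a b => w b a) v u S R = greens w u v R S := by
  refine eq_greens w R S (fun u v => greens (fun a b => w b a) v u S R) ?_ ?_ u v
  · intro u v h
    exact greens_of_not_le _ (by omega)
  · intro u v _ _
    rw [greens_eq]
    simp only [and_comm]
    ring

theorem greens_neg (w : ℤ → ℤ → F) (u v R S : ℤ) :
    greens (fun a b => w (-a) (-b)) (-R) (-S) (-u) (-v) = greens w u v R S := by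
  refine eq_greens w R S (fun u v => greens (fun a b => w (-a) (-b)) (-R) (-S) (-u) (-v)) ?_ ?_ u v
  · intro u v h
    exact greens_of_not_le _ (by omega)
  · intro u v _ _
    rw [greens_eq_last]
    have e1 : (-R = -u ∧ -S = -v) ↔ (u = R ∧ v = S) := by omega
    simp only [e1, neg_neg]
    rw [show -u - 1 = -(u + 1) by ring, show -v - 1 = -(v + 1) by ring]

theorem greens_shift (w : ℤ → ℤ → F) (a b u v R S : ℤ) :
    greens (fun x y => w (x - a) (y - b)) u v R S = greens w (u - a) (v - b) (R - a) (S - b) := by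
  symm
  refine eq_greens _ R S (fun u v => greens w (u - a) (v - b) (R - a) (S - b)) ?_ ?_ u v
  · intro u v h
    exact greens_of_not_le _ (by omega)
  · intro u v _ _
    rw [greens_eq]
    have e1 : (u - a = R - a ∧ v - b = S - b) ↔ (u = R ∧ v = S) := by omega
    simp only [e1]
    rw [show u + 1 - a = u - a + 1 by ring, show v + 1 - b = v - b + 1 by ring]

theorem greens_eq_zero_of_level (w : ℤ → ℤ → F) {u v R S : ℤ} (h : u + v = R + S)
    (hne : ¬(u = R ∧ v = S)) : greens w u v R S = 0 :=
  greens_of_not_le w (by omega)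

theorem greens_horizontal (w : ℤ → ℤ → F) (u v R : ℤ) (h : u ≤ R) :
    greens w u v R v = ∏ x ∈ Finset.Icc u R, w x v := by
  obtain ⟨d, rfl⟩ : ∃ d : ℕ, R = u + d := ⟨(R - u).toNat, by omega⟩
  induction d generalizing u with
  | zero => simp [greens_self]
  | succ d ih =>
    rw [greens_step w (by omega), greens_of_not_le w (v := v + 1) (by omega), add_zero]
    have h1 := ih (u + 1) (by omega)
    rw [show u + 1 + (d : ℤ) = u + ((d + 1 : ℕ) : ℤ) by push_cast; ring] at h1
    rw [h1, ← Finset.insert_Icc_add_one_left_eq_Icc h, Finset.prod_insert (by simp)]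

end PathSums

/-! ### Normalized path determinants and their three-term relations. -/

section PathDeterminants

variable {F : Type*} [Field F]

/-- The matrix of path sums from the antidiagonal of sources at `(m, n)` to the antidiagonal of
sinks at `(R, S)`. -/
def pathMatrix (w : ℤ → ℤ → F) (t : ℕ) (m n R S : ℤ) : Matrix (Fin t) (Fin t) F :=
  Matrix.of fun a b => greens w (m + t - 1 - (a : ℕ)) (n + (a : ℕ)) (R - (b : ℕ))
    (S - t + 1 + (b : ℕ))

/-- The determinant of `pathMatrix`, multiplied by the weights of the vertices below the sources
and above the sinks. -/
def pathDet (w : ℤ → ℤ → F) (t : ℕ) (m n R S : ℤ) : F :=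
  staircaseProd t (fun i a => w (m + i) (n + a)) * staircaseProd t (fun i a => w (R - i) (S - a)) *
    (pathMatrix w t m n R S).det

theorem pathDet_swap (w : ℤ → ℤ → F) (t : ℕ) (m n R S : ℤ) :
    pathDet (fun x y => w y x) t n m S R = pathDet w t m n R S := by
  have h : pathMatrix (fun x y => w y x) t n m S R =
      (pathMatrix w t m n R S).submatrix Fin.revPerm Fin.revPerm := by
    ext a b
    have ha := a.2
    have hb := b.2
    simp only [pathMatrix, Matrix.of_apply, Matrix.submatrix_apply, Fin.revPerm_apply, Fin.val_rev]
    rw [greens_swap]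
    congr 1 <;> omega
  rw [pathDet, pathDet, h, Matrix.det_submatrix_equiv_self,
    staircaseProd_swap t (fun i a => w (m + i) (n + a)),
    staircaseProd_swap t (fun i a => w (R - i) (S - a))]

/-- Point reflection exchanges sources and sinks, hence transposes the matrix. It turns a relation
with fixed sinks into one with fixed sources. -/
theorem pathDet_neg (w : ℤ → ℤ → F) (t : ℕ) (m n R S : ℤ) :
    pathDet (fun x y => w (-x) (-y)) t (-R) (-S) (-m) (-n) = pathDet w t m n R S := by
  have h : pathMatrix (fun x y => w (-x) (-y)) t (-R) (-S) (-m) (-n) =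
      ((pathMatrix w t m n R S).submatrix Fin.revPerm Fin.revPerm).transpose := by
    ext a b
    have ha := a.2
    have hb := b.2
    simp only [pathMatrix, Matrix.of_apply, Matrix.submatrix_apply, Fin.revPerm_apply, Fin.val_rev,
      Matrix.transpose_apply]
    rw [← greens_neg w]
    congr 1 <;> omega
  rw [pathDet, pathDet, h, Matrix.det_transpose, Matrix.det_submatrix_equiv_self]
  have e1 : staircaseProd t (fun i a => w (-(-R + i)) (-(-S + a))) =
      staircaseProd t (fun i a => w (R - i) (S - a)) := by
    congr 1; funext i a; congr 1 <;> ring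
  have e2 : staircaseProd t (fun i a => w (-(-m - i)) (-(-n - a))) =
      staircaseProd t (fun i a => w (m + i) (n + a)) := by
    congr 1; funext i a; congr 1 <;> ring
  rw [e1, e2]
  ring

theorem pathDet_shift (w : ℤ → ℤ → F) (t : ℕ) (a b m n R S : ℤ) :
    pathDet (fun x y => w (x - a) (y - b)) t m n R S =
      pathDet w t (m - a) (n - b) (R - a) (S - b) := by
  have h : pathMatrix (fun x y => w (x - a) (y - b)) t m n R S =
      pathMatrix w t (m - a) (n - b) (R - a) (S - b) := by
    ext x y
    simp only [pathMatrix, Matrix.of_apply]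
    rw [greens_shift]
    congr 1 <;> ring
  rw [pathDet, pathDet, h]
  congr 3
  · funext i a; congr 1 <;> ring
  · funext i a; congr 1 <;> ring

theorem pathDet_zero (w : ℤ → ℤ → F) (m n R S : ℤ) : pathDet w 0 m n R S = 1 := by
  simp [pathDet, staircaseProd]

theorem pathDet_one (w : ℤ → ℤ → F) (m n R S : ℤ) : pathDet w 1 m n R S = greens w m n R S := by
  simp [pathDet, staircaseProd, pathMatrix]

/-- An extreme source lies beyond all sinks, which gives a zero row. This matches the zero label of
a neighbour off the rectangle. -/
theorem pathDet_eq_zero (w : ℤ → ℤ → F) {t : ℕ} {m n R S : ℤ} (ht : 1 ≤ t)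
    (h : R < m + t - 1 ∨ S < n + t - 1) : pathDet w t m n R S = 0 := by
  have : (pathMatrix w t m n R S).det = 0 := by
    rcases h with h | h
    · refine Matrix.det_eq_zero_of_row_eq_zero ⟨0, ht⟩ fun b => ?_
      simp only [pathMatrix, Matrix.of_apply]
      exact greens_of_not_le w (by push_cast; omega)
    · refine Matrix.det_eq_zero_of_row_eq_zero ⟨t - 1, by omega⟩ fun b => ?_
      have hb := b.2
      simp only [pathMatrix, Matrix.of_apply]
      exact greens_of_not_le w (by omega)
  rw [pathDet, this, mul_zero]

/-- The last-step recursion moves the sinks to the column `R` and absorbs the upper staircase. The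
bound puts the antidiagonal of sources at or below that of the sinks, so the indicator term of the
recursion never occurs. -/
theorem det_right_ends (w : ℤ → ℤ → F) {t : ℕ} {m n R S : ℤ}
    (h : 2 * (t : ℤ) ≤ R - m + (S - n) + 2) :
    Matrix.det (Matrix.of fun a b : Fin t =>
      greens w (m + t - 1 - (a : ℕ)) (n + (a : ℕ)) R (S - t + 1 + (b : ℕ))) =
      staircaseProd t (fun i a => w (R - i) (S - a)) * (pathMatrix w t m n R S).det := by
  have key := det_staircase_horizontal (t := t)
    (fun i a p => greens w (m + t - 1 - (p : ℕ)) (n + (p : ℕ)) (R - a) (S - i))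
    (fun i a => w (R - a) (S - i)) (fun i a hia => by
      funext p
      simp only [Pi.smul_apply, Pi.add_apply, smul_eq_mul]
      rw [greens_step_last w (by omega), add_comm]
      push_cast
      rw [show R - (a : ℤ) - 1 = R - (a + 1) by ring, show S - (i : ℤ) - 1 = S - (i + 1) by ring])
  rw [staircaseProd_swap t (fun i a => w (R - i) (S - a))] at key
  rw [← Matrix.det_transpose, ← Matrix.det_transpose (pathMatrix w t m n R S)]
  convert key using 3
  · ext b p
    have hb := b.2
    simp only [Matrix.transpose_apply, Matrix.of_apply]
    congr 1 <;> omega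
  · ext b p
    have hb := b.2
    simp only [Matrix.transpose_apply, Matrix.of_apply, pathMatrix]
    congr 1
    omega

/-- This explains the normalization: disjoint paths that start on the column `m` are forced to run
straight to the antidiagonal of sources, and the forced segments fill the staircase. The same holds
at the sinks. -/
theorem pathDet_eq_det_vertical (w : ℤ → ℤ → F) {t : ℕ} {m n R S : ℤ}
    (h : 2 * (t : ℤ) ≤ R - m + (S - n) + 2) :
    pathDet w t m n R S = Matrix.det (Matrix.of fun a b : Fin t =>
      greens w m (n + (a : ℕ)) R (S - t + 1 + (b : ℕ))) := by
  have key := det_staircase_vertical (t := t)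
    (fun i a b => greens w (m + i) (n + a) R (S - t + 1 + (b : ℕ)))
    (fun i a => w (m + i) (n + a)) (fun i a hia => by
      funext b
      simp only [Pi.smul_apply, Pi.add_apply, smul_eq_mul]
      rw [greens_step w (by omega)]
      push_cast
      rw [show m + (i : ℤ) + 1 = m + (i + 1) by ring, show n + (a : ℤ) + 1 = n + (a + 1) by ring])
  have e1 : (Matrix.of fun a b : Fin t =>
      greens w m (n + (a : ℕ)) R (S - t + 1 + (b : ℕ))) = Matrix.of fun a b : Fin t =>
      greens w (m + (0 : ℕ)) (n + (a : ℕ)) R (S - t + 1 + (b : ℕ)) := by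
    ext; simp
  rw [e1, pathDet, mul_assoc, ← det_right_ends w h]
  refine Eq.trans ?_ key.symm
  congr 2
  ext a b
  have ha := a.2
  simp only [Matrix.of_apply]
  congr 1
  omega

theorem pathDet_eq_det_horizontal (w : ℤ → ℤ → F) {t : ℕ} {m n R S : ℤ}
    (h : 2 * (t : ℤ) ≤ R - m + (S - n) + 2) :
    pathDet w t m n R S = Matrix.det (Matrix.of fun a b : Fin t =>
      greens w (m + t - 1 - (a : ℕ)) n R (S - t + 1 + (b : ℕ))) := by
  have key := det_staircase_horizontal (t := t)
    (fun i a b => greens w (m + i) (n + a) R (S - t + 1 + (b : ℕ)))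
    (fun i a => w (m + i) (n + a)) (fun i a hia => by
      funext b
      simp only [Pi.smul_apply, Pi.add_apply, smul_eq_mul]
      rw [greens_step w (by omega)]
      push_cast
      rw [show m + (i : ℤ) + 1 = m + (i + 1) by ring, show n + (a : ℤ) + 1 = n + (a + 1) by ring])
  have e1 : (Matrix.of fun a b : Fin t =>
      greens w (m + t - 1 - (a : ℕ)) n R (S - t + 1 + (b : ℕ))) = Matrix.of fun a b : Fin t =>
      greens w (m + (t - 1 - a : ℕ)) (n + (0 : ℕ)) R (S - t + 1 + (b : ℕ)) := by
    ext a b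
    have ha := a.2
    simp only [Matrix.of_apply]
    congr 1 <;> omega
  rw [e1, pathDet, mul_assoc, ← det_right_ends w h]
  refine Eq.trans ?_ key.symm
  congr 2
  ext a b
  have ha := a.2
  simp only [Matrix.of_apply]
  congr 1
  omega

/-- The condensation relation with both corners moving vertically. -/
theorem pathDet_condensation (w : ℤ → ℤ → F) {d : ℕ} {m n R S : ℤ}
    (h : 2 * (d : ℤ) + 1 ≤ R - m + (S - n)) :
    pathDet w (d + 2) m n R (S + 1) * pathDet w d m (n + 1) R S +
      pathDet w (d + 1) m (n + 1) R S * pathDet w (d + 1) m n R (S + 1) =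
      pathDet w (d + 1) m n R S * pathDet w (d + 1) m (n + 1) R (S + 1) := by
  rw [pathDet_eq_det_vertical w (t := d + 2) (by push_cast; omega),
    pathDet_eq_det_vertical w (t := d) (by omega),
    pathDet_eq_det_vertical w (t := d + 1) (n := n + 1) (S := S) (by push_cast; omega),
    pathDet_eq_det_vertical w (t := d + 1) (n := n) (S := S + 1) (by push_cast; omega),
    pathDet_eq_det_vertical w (t := d + 1) (n := n) (S := S) (by push_cast; omega),
    pathDet_eq_det_vertical w (t := d + 1) (n := n + 1) (S := S + 1) (by push_cast; omega)]
  have key := det_mul_det_interior (d := d)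
    (fun a b => greens w m (n + (a : ℕ)) R (S - d + (b : ℕ)))
  convert key using 3 <;> (try congr 1) <;> ext a b <;> (try simp only [Matrix.of_apply]) <;>
    congr 1 <;> push_cast <;> ring

theorem det_eq_prod_mul_det_of_rows {N : ℕ} (A B : Fin (N + 1) → Fin (N + 1) → F) (c δ : Fin N → F)
    (h0 : A 0 = B 0) (hs : ∀ i, A i.succ = c i • (B i.succ + δ i • A i.castSucc)) :
    (Matrix.of A).det = (∏ i, c i) * (Matrix.of B).det := by
  have h1 := Matrix.det_mul_column (Fin.cons 1 c : Fin (N + 1) → F) (Matrix.of B)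
  rw [Fin.prod_univ_succ] at h1
  simp only [Fin.cons_zero, one_mul, Fin.cons_succ] at h1
  rw [← h1]
  refine Matrix.det_eq_of_forall_row_eq_smul_add_pred (fun i => c i * δ i) ?_ ?_
  · intro j
    simp [h0]
  · intro i j
    simp only [Matrix.of_apply, Fin.cons_succ]
    rw [hs i]
    simp only [Pi.smul_apply, Pi.add_apply, smul_eq_mul]
    ring

/-- The octahedron relation with the sinks fixed. -/
theorem pathDet_octahedron (w : ℤ → ℤ → F) {k : ℕ} {m n R S : ℤ}
    (h : 2 * (k : ℤ) + 1 ≤ R - m + (S - n)) :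
    w m n * (pathDet w (k + 1) (m + 1) n R S * pathDet w k m (n + 1) R S +
      pathDet w (k + 1) m (n + 1) R S * pathDet w k (m + 1) n R S) =
      pathDet w (k + 1) m n R S * pathDet w k (m + 1) (n + 1) R S := by
  obtain _ | d := k
  -- For `k = 0` the relation is the first-step recursion.
  · simp only [zero_add, pathDet_zero, pathDet_one, mul_one]
    rw [greens_step w (u := m) (v := n) (by omega)]
  -- Sources at heights `n` and `n + 1`, related by the first-step recursion. Row operations trade
  -- all but the first row at height `n` for rows at height `n + 1`, so that the six determinants
  -- fit one three-term relation.
  let hrow : ℤ → Fin (d + 2) → F := fun u b => greens w u n R (S - d - 1 + (b : ℕ))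
  let qrow : ℤ → Fin (d + 2) → F := fun u b => greens w u (n + 1) R (S - d - 1 + (b : ℕ))
  have hstep : ∀ u, u ≤ m + d + 1 → hrow u = w u n • (hrow (u + 1) + qrow u) := by
    intro u hu
    funext b
    simp only [hrow, qrow, Pi.smul_apply, Pi.add_apply, smul_eq_mul]
    rw [greens_step w (by push_cast at h; omega)]
  let B : Fin d → Fin (d + 2) → F := fun a => qrow (m + d - (a : ℕ))
  -- A family with one path fewer lacks the lowest sink; this unit row deletes its column.
  let e : Fin (d + 2) → F := Pi.single 0 1
  have key := det_three_term B e (hrow (m + d + 1)) (qrow (m + d + 1)) (qrow m)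
  have cB : (Fin.snoc B (qrow m) : Fin (d + 1) → Fin (d + 2) → F) =
      fun a : Fin (d + 1) => qrow (m + d - (a : ℕ)) := by
    funext a
    refine Fin.lastCases ?_ (fun a => ?_) a <;> simp [B]
  have cq : (Fin.cons (qrow (m + d + 1)) B : Fin (d + 1) → Fin (d + 2) → F) =
      fun a : Fin (d + 1) => qrow (m + d + 1 - (a : ℕ)) := by
    funext a
    refine Fin.cases ?_ (fun a => ?_) a <;> simp [B]
  have d1 := det_eq_prod_mul_det_of_rows (fun a : Fin (d + 2) => hrow (m + d + 1 - (a : ℕ)))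
    (Fin.cons (hrow (m + d + 1)) fun a : Fin (d + 1) => qrow (m + d - (a : ℕ)))
    (fun i => w (m + d - (i : ℕ)) n) (fun _ => 1) (by simp) (fun i => by
      have hi := i.2
      simp only [Fin.cons_succ, one_smul, Fin.val_succ, Fin.val_castSucc]
      rw [add_comm (qrow _)]
      convert hstep (m + d - (i : ℕ)) (by omega) using 2
      · push_cast; ring
      · congr 2; ring)
  have d2 := det_eq_prod_mul_det_of_rows
    (Fin.cons e fun a : Fin (d + 1) => hrow (m + d + 1 - (a : ℕ)))
    (Fin.cons e (Fin.cons (hrow (m + d + 1)) B : Fin (d + 1) → Fin (d + 2) → F))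
    (Fin.cons 1 fun i : Fin d => w (m + d - (i : ℕ)) n) (Fin.cons 0 fun _ => 1) (by simp)
    (fun i => by
      refine Fin.cases ?_ (fun i => ?_) i
      · simp
      · have hi := i.2
        simp only [Fin.cons_succ, one_smul, Fin.val_succ, Fin.castSucc_succ, Fin.val_castSucc, B]
        rw [add_comm (qrow _)]
        convert hstep (m + d - (i : ℕ)) (by omega) using 2
        · push_cast; ring
        · congr 2; ring)
  have d3 := det_eq_prod_mul_det_of_rows (fun a : Fin (d + 2) => hrow (m + d + 2 - (a : ℕ)))
    (Fin.cons (hrow (m + d + 2)) fun a : Fin (d + 1) => qrow (m + d + 1 - (a : ℕ)))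
    (fun i => w (m + d + 1 - (i : ℕ)) n) (fun _ => 1) (by simp) (fun i => by
      have hi := i.2
      simp only [Fin.cons_succ, one_smul, Fin.val_succ, Fin.val_castSucc]
      rw [add_comm (qrow _)]
      convert hstep (m + d + 1 - (i : ℕ)) (by omega) using 2
      · push_cast; ring
      · congr 2; ring)
  -- The row `qrow (m + d + 1)` is already present, so its contribution to the recursion for `hrow
  -- (m + d + 1)` drops out.
  have d4 : w (m + d + 1) n * Matrix.det (Matrix.of (Fin.cons (hrow (m + d + 2))
      fun a : Fin (d + 1) => qrow (m + d + 1 - (a : ℕ)))) =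
      Matrix.det (Matrix.of (Fin.cons (hrow (m + d + 1))
        fun a : Fin (d + 1) => qrow (m + d + 1 - (a : ℕ)))) := by
    let D : (Fin (d + 2) → F) [⋀^Fin (d + 2)]→ₗ[F] F := Matrix.detRowAlternating
    let tl : Fin (d + 1) → Fin (d + 2) → F := fun a => qrow (m + d + 1 - (a : ℕ))
    have h1 := hstep (m + d + 1) le_rfl
    rw [show m + (d : ℤ) + 1 + 1 = m + d + 2 by ring] at h1
    have h2 : D (Fin.cons (w (m + d + 1) n • (hrow (m + d + 2) + qrow (m + d + 1))) tl) =
        w (m + d + 1) n * (D (Fin.cons (hrow (m + d + 2)) tl) +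
          D (Fin.cons (qrow (m + d + 1)) tl)) := by
      rw [← smul_eq_mul]
      exact (D.toMultilinearMap.cons_smul _ _ _).trans
        (congrArg _ (D.toMultilinearMap.cons_add _ _ _))
    have h3 : D (Fin.cons (qrow (m + d + 1)) tl) = 0 :=
      D.map_eq_zero_of_eq _ (i := 0) (j := 1) (by
        change _ = tl 0
        simp [tl]) (by simp)
    rw [h3, add_zero, ← h1] at h2
    exact h2.symm
  have p1 : ∏ i : Fin (d + 1), w (m + d - (i : ℕ)) n =
      (∏ i : Fin d, w (m + d - (i : ℕ)) n) * w m n := by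
    rw [Fin.prod_univ_castSucc]
    simp
  have p3 : ∏ i : Fin (d + 1), w (m + d + 1 - (i : ℕ)) n =
      w (m + d + 1) n * ∏ i : Fin d, w (m + d - (i : ℕ)) n := by
    rw [Fin.prod_univ_succ]
    simp
  have p2 : ∏ i : Fin (d + 1), (Fin.cons 1 fun i : Fin d => w (m + d - (i : ℕ)) n :
      Fin (d + 1) → F) i = ∏ i : Fin d, w (m + d - (i : ℕ)) n := by
    rw [Fin.prod_univ_succ]
    simp
  rw [p1] at d1
  rw [p2, det_cons_single_zero, det_cons_single_zero] at d2
  rw [p3, mul_right_comm, d4] at d3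
  rw [cB, cq, det_cons_single_zero, det_cons_single_zero, det_cons_single_zero] at key
  push_cast at h
  have E1 : pathDet w (d + 1 + 1) m n R S =
      Matrix.det (Matrix.of fun a : Fin (d + 2) => hrow (m + d + 1 - (a : ℕ))) := by
    rw [pathDet_eq_det_horizontal w (by push_cast; omega)]
    congr 1; ext a b
    simp only [Matrix.of_apply, hrow]
    congr 1 <;> push_cast <;> ring
  have E2 : pathDet w (d + 1) (m + 1) n R S =
      Matrix.det (Matrix.of fun a b : Fin (d + 1) => hrow (m + d + 1 - (a : ℕ)) b.succ) := by
    rw [pathDet_eq_det_horizontal w (by push_cast; omega)]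
    congr 1; ext a b
    simp only [Matrix.of_apply, hrow, Fin.val_succ]
    congr 1 <;> push_cast <;> ring
  have E3 : pathDet w (d + 1 + 1) (m + 1) n R S =
      Matrix.det (Matrix.of fun a : Fin (d + 2) => hrow (m + d + 2 - (a : ℕ))) := by
    rw [pathDet_eq_det_horizontal w (by push_cast; omega)]
    congr 1; ext a b
    simp only [Matrix.of_apply, hrow]
    congr 1 <;> push_cast <;> ring
  have E4 : pathDet w (d + 1) m (n + 1) R S =
      Matrix.det (Matrix.of fun a b : Fin (d + 1) => qrow (m + d - (a : ℕ)) b.succ) := by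
    rw [pathDet_eq_det_horizontal w (by push_cast; omega)]
    congr 1; ext a b
    simp only [Matrix.of_apply, qrow, Fin.val_succ]
    congr 1 <;> push_cast <;> ring
  have E5 : pathDet w (d + 1 + 1) m (n + 1) R S =
      Matrix.det (Matrix.of (Fin.cons (qrow (m + d + 1))
        fun a : Fin (d + 1) => qrow (m + d - (a : ℕ)) : Fin (d + 2) → _)) := by
    rw [pathDet_eq_det_horizontal w (by push_cast; omega)]
    congr 1; ext a b
    refine Fin.cases ?_ (fun a => ?_) a <;>
    simp only [Matrix.of_apply, qrow, Fin.cons_zero, Fin.cons_succ, Fin.val_zero, Fin.val_succ] <;>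
    congr 1 <;> push_cast <;> ring
  have E6 : pathDet w (d + 1) (m + 1) (n + 1) R S =
      Matrix.det (Matrix.of fun a b : Fin (d + 1) => qrow (m + d + 1 - (a : ℕ)) b.succ) := by
    rw [pathDet_eq_det_horizontal w (by push_cast; omega)]
    congr 1; ext a b
    simp only [Matrix.of_apply, qrow, Fin.val_succ]
    congr 1 <;> push_cast <;> ring
  rw [E1, E2, E3, E4, E5, E6, d1, d2, d3]
  linear_combination (w m n * ∏ i : Fin d, w (m + d - (i : ℕ)) n) * key

/-- The octahedron relation with the sources fixed. -/
theorem pathDet_octahedron_neg (w : ℤ → ℤ → F) {k : ℕ} {m n R S : ℤ}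
    (h : 2 * (k : ℤ) + 1 ≤ R - m + (S - n)) :
    w R S * (pathDet w (k + 1) m n (R - 1) S * pathDet w k m n R (S - 1) +
      pathDet w (k + 1) m n R (S - 1) * pathDet w k m n (R - 1) S) =
      pathDet w (k + 1) m n R S * pathDet w k m n (R - 1) (S - 1) := by
  have key := pathDet_octahedron (fun x y => w (-x) (-y)) (k := k) (m := -R) (n := -S)
    (R := -m) (S := -n) (by omega)
  rw [show -R + 1 = -(R - 1) by ring, show -S + 1 = -(S - 1) by ring] at key
  simpa only [pathDet_neg, neg_neg] using key

/-- The product of the weights over a rectangle. -/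
noncomputable def rectProd (w : ℤ → ℤ → F) (m n R S : ℤ) : F :=
  ∏ p ∈ Finset.Icc m R ×ˢ Finset.Icc n S, w p.1 p.2

theorem prod_fin_eq_prod_Icc (f : ℤ → F) {t : ℕ} {n S : ℤ} (h : (t : ℤ) = S - n + 1) :
    ∏ a : Fin t, f (n + (a : ℕ)) = ∏ y ∈ Finset.Icc n S, f y := by
  refine Finset.prod_bij (fun a _ => n + ((a : ℕ) : ℤ)) ?_ ?_ ?_ ?_
  · intro a _
    have := a.2
    rw [Finset.mem_Icc]
    omega
  · intro a _ b _ hab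
    ext
    omega
  · intro y hy
    rw [Finset.mem_Icc] at hy
    exact ⟨⟨(y - n).toNat, by omega⟩, Finset.mem_univ _, by push_cast; omega⟩
  · intro a _
    rfl

/-- With one path for each row of the rectangle, all paths are horizontal: the matrix in vertical
form is triangular, with the products of the rows on its diagonal. -/
theorem pathDet_full (w : ℤ → ℤ → F) {t : ℕ} {m n R S : ℤ} (h : (t : ℤ) = S - n + 1)
    (h' : (t : ℤ) ≤ R - m + 1) (hR : m ≤ R) : pathDet w t m n R S = rectProd w m n R S := by
  rw [pathDet_eq_det_vertical w (by omega), Matrix.det_of_isUpperTriangular]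
  · have e : ∀ a : Fin t, (Matrix.of fun a b : Fin t =>
        greens w m (n + (a : ℕ)) R (S - t + 1 + (b : ℕ))) a a =
        ∏ x ∈ Finset.Icc m R, w x (n + (a : ℕ)) := by
      intro a
      rw [← greens_horizontal w _ _ _ hR]
      simp only [Matrix.of_apply]
      congr 1
      omega
    rw [Finset.prod_congr rfl fun a _ => e a,
      prod_fin_eq_prod_Icc (fun y => ∏ x ∈ Finset.Icc m R, w x y) h, rectProd,
      Finset.prod_product, Finset.prod_comm]
  · intro a b hab
    simp only [Matrix.of_apply]
    have : (b : ℕ) < a := hab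
    exact greens_of_not_le w (by omega)

theorem pathDet_full_swap (w : ℤ → ℤ → F) {t : ℕ} {m n R S : ℤ} (h : (t : ℤ) = R - m + 1)
    (h' : (t : ℤ) ≤ S - n + 1) (hS : n ≤ S) : pathDet w t m n R S = rectProd w m n R S := by
  rw [← pathDet_swap, pathDet_full _ h h' hS]
  simp only [rectProd]
  rw [Finset.prod_product, Finset.prod_product, Finset.prod_comm]

theorem rectProd_succ_left (w : ℤ → ℤ → F) {m n R S : ℤ} (h : m ≤ R) :
    rectProd w m n R S = (∏ y ∈ Finset.Icc n S, w m y) * rectProd w (m + 1) n R S := by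
  rw [rectProd, rectProd, Finset.prod_product, Finset.prod_product,
    ← Finset.insert_Icc_add_one_left_eq_Icc h, Finset.prod_insert (by simp)]

theorem rectProd_succ_right (w : ℤ → ℤ → F) {m n R S : ℤ} (h : m ≤ R + 1) :
    rectProd w m n (R + 1) S = rectProd w m n R S * ∏ y ∈ Finset.Icc n S, w (R + 1) y := by
  rw [rectProd, rectProd, Finset.prod_product, Finset.prod_product,
    ← Finset.insert_Icc_right_eq_Icc_add_one h, Finset.prod_insert (by simp), mul_comm]

end PathDeterminants

/-! ### The Lindström–Gessel–Viennot formula between two antidiagonals. -/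

section LatticePaths

variable {F : Type*} [Field F]

/-- The unit step `(1,0)` or `(0,1)`. -/
def unitStep (ε : Bool) : ℤ × ℤ := if ε then (1, 0) else (0, 1)

/-- The lattice paths with `N` steps that start at `p`. -/
def latticePaths : ℕ → ℤ × ℤ → Finset (List (ℤ × ℤ))
  | 0, p => {[p]}
  | N + 1, p => (Finset.univ.biUnion fun ε => latticePaths N (p + unitStep ε)).image (List.cons p)

theorem mem_latticePaths_succ {N : ℕ} {p : ℤ × ℤ} {L : List (ℤ × ℤ)} :
    L ∈ latticePaths (N + 1) p ↔ ∃ ε, ∃ L' ∈ latticePaths N (p + unitStep ε), p :: L' = L := by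
  simp only [latticePaths, Finset.mem_image, Finset.mem_biUnion, Finset.mem_univ, true_and]
  constructor
  · rintro ⟨L', ⟨ε, h⟩, rfl⟩
    exact ⟨ε, L', h, rfl⟩
  · rintro ⟨ε, L', h, rfl⟩
    exact ⟨L', ⟨ε, h⟩, rfl⟩

theorem unitStep_level (p : ℤ × ℤ) (ε : Bool) :
    (p + unitStep ε).1 + (p + unitStep ε).2 = p.1 + p.2 + 1 := by
  cases ε <;> simp [unitStep] <;> ring

theorem unitStep_fst (p : ℤ × ℤ) (ε : Bool) :
    p.1 ≤ (p + unitStep ε).1 ∧ (p + unitStep ε).1 ≤ p.1 + 1 := by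
  cases ε <;> simp [unitStep]

theorem head_of_mem_latticePaths {N : ℕ} {p : ℤ × ℤ} {L : List (ℤ × ℤ)}
    (h : L ∈ latticePaths N p) : ∃ T, L = p :: T := by
  obtain _ | N := N
  · exact ⟨[], by simpa [latticePaths] using h⟩
  · obtain ⟨ε, L', _, rfl⟩ := mem_latticePaths_succ.mp h
    exact ⟨L', rfl⟩

theorem isLatticePath_of_mem {N : ℕ} {p : ℤ × ℤ} {L : List (ℤ × ℤ)}
    (h : L ∈ latticePaths N p) : IsLatticePath L := by
  induction N generalizing p L with
  | zero =>
    have : L = [p] := by simpa [latticePaths] using h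
    subst this
    simp [IsLatticePath]
  | succ N ih =>
    obtain ⟨ε, L', hL', rfl⟩ := mem_latticePaths_succ.mp h
    have h1 := ih hL'
    obtain ⟨T, rfl⟩ := head_of_mem_latticePaths hL'
    refine List.isChain_cons_cons.mpr ⟨?_, h1⟩
    cases ε <;> simp [unitStep]

theorem mem_latticePaths_of_isLatticePath {p : ℤ × ℤ} {T : List (ℤ × ℤ)}
    (h : IsLatticePath (p :: T)) : p :: T ∈ latticePaths T.length p := by
  induction T generalizing p with
  | nil => simp [latticePaths]
  | cons q T ih =>
    obtain ⟨h1, h2⟩ := List.isChain_cons_cons.mp h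
    refine mem_latticePaths_succ.mpr ?_
    rcases h1 with rfl | rfl
    · exact ⟨true, _, ih h2, rfl⟩
    · exact ⟨false, _, ih h2, rfl⟩

theorem ge_of_mem_latticePaths {N : ℕ} {p : ℤ × ℤ} {L : List (ℤ × ℤ)}
    (h : L ∈ latticePaths N p) {v : ℤ × ℤ} (hv : v ∈ L) : p.1 ≤ v.1 ∧ p.2 ≤ v.2 := by
  induction N generalizing p L with
  | zero =>
    have : L = [p] := by simpa [latticePaths] using h
    subst this
    simp at hv
    simp [hv]
  | succ N ih =>
    obtain ⟨ε, L', hL', rfl⟩ := mem_latticePaths_succ.mp h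
    rcases List.mem_cons.mp hv with rfl | hv
    · simp
    · have h1 := ih hL' hv
      have h2 := unitStep_level p ε
      have h3 := unitStep_fst p ε
      omega

theorem le_last_of_mem_latticePaths {N : ℕ} {p q : ℤ × ℤ} {L : List (ℤ × ℤ)}
    (h : L ∈ latticePaths N p) (hq : L.getLast? = some q) {v : ℤ × ℤ} (hv : v ∈ L) :
    v.1 ≤ q.1 ∧ v.2 ≤ q.2 := by
  induction N generalizing p L v with
  | zero =>
    have : L = [p] := by simpa [latticePaths] using h
    subst this
    simp at hv hq
    simp [hv, hq]
  | succ N ih =>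
    obtain ⟨ε, L', hL', rfl⟩ := mem_latticePaths_succ.mp h
    obtain ⟨T, rfl⟩ := head_of_mem_latticePaths hL'
    rw [List.getLast?_cons_cons] at hq
    rcases List.mem_cons.mp hv with rfl | hv
    · have h1 := ih hL' hq (List.mem_cons_self)
      have h2 := unitStep_level v ε
      have h3 := unitStep_fst v ε
      omega
    · exact ih hL' hq hv

theorem level_last_of_mem_latticePaths {N : ℕ} {p q : ℤ × ℤ} {L : List (ℤ × ℤ)}
    (h : L ∈ latticePaths N p) (hq : L.getLast? = some q) : q.1 + q.2 = p.1 + p.2 + N := by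
  induction N generalizing p L with
  | zero =>
    have : L = [p] := by simpa [latticePaths] using h
    subst this
    simp at hq
    simp [hq]
  | succ N ih =>
    obtain ⟨ε, L', hL', rfl⟩ := mem_latticePaths_succ.mp h
    obtain ⟨T, rfl⟩ := head_of_mem_latticePaths hL'
    rw [List.getLast?_cons_cons] at hq
    have h1 := ih hL' hq
    have h2 := unitStep_level p ε
    push_cast
    omega

open Classical in
/-- The families of vertex-disjoint lattice paths with `N` steps, from the points `p` to the
points `q` in some order. -/
noncomputable def disjointPaths {t : ℕ} (N : ℕ) (p q : Fin t → ℤ × ℤ) :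
    Finset (Fin t → List (ℤ × ℤ)) :=
  (Fintype.piFinset fun a => latticePaths N (p a)).filter fun L =>
    (∃ σ : Equiv.Perm (Fin t), ∀ a, (L a).getLast? = some (q (σ a))) ∧
      ∀ a b, a ≠ b → List.Disjoint (L a) (L b)

theorem mem_disjointPaths {t N : ℕ} {p q : Fin t → ℤ × ℤ} {L : Fin t → List (ℤ × ℤ)} :
    L ∈ disjointPaths N p q ↔ (∀ a, L a ∈ latticePaths N (p a)) ∧
      (∃ σ : Equiv.Perm (Fin t), ∀ a, (L a).getLast? = some (q (σ a))) ∧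
      ∀ a b, a ≠ b → List.Disjoint (L a) (L b) := by
  simp [disjointPaths]

/-- Each step raises the level `u + v`, so a starting point on the common antidiagonal cannot lie on
the remainder of any path. -/
theorem cons_mem_disjointPaths {t N : ℕ} {d : ℤ} {p q : Fin t → ℤ × ℤ} (ε : Fin t → Bool)
    (hp : ∀ a, (p a).1 + (p a).2 = d) (hinj : Function.Injective p) {L : Fin t → List (ℤ × ℤ)}
    (hL : ∀ a, L a ∈ latticePaths N (p a + unitStep (ε a))) :
    (fun a => p a :: L a) ∈ disjointPaths (N + 1) p q ↔
      L ∈ disjointPaths N (fun a => p a + unitStep (ε a)) q := by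
  have h1 : ∀ a, p a :: L a ∈ latticePaths (N + 1) (p a) :=
    fun a => mem_latticePaths_succ.mpr ⟨ε a, L a, hL a, rfl⟩
  have h2 : ∀ a, (p a :: L a).getLast? = (L a).getLast? := by
    intro a
    obtain ⟨T, hT⟩ := head_of_mem_latticePaths (hL a)
    rw [hT, List.getLast?_cons_cons]
  have h3 : ∀ a b, p a ∉ L b := by
    intro a b hab
    have h4 := ge_of_mem_latticePaths (hL b) hab
    have h5 := unitStep_level (p b) (ε b)
    have := hp a
    have := hp b
    omega
  rw [mem_disjointPaths, mem_disjointPaths]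
  simp only [h1, hL, h2, implies_true, true_and]
  refine and_congr_right fun _ => forall_congr' fun a => forall_congr' fun b => ?_
  refine imp_congr_right fun hab => ?_
  rw [List.disjoint_cons_left, List.disjoint_cons_right, List.mem_cons, not_or]
  exact ⟨fun h => h.2.2, fun h => ⟨⟨fun h => hab (hinj h), h3 a b⟩, h3 b a, h⟩⟩

theorem sum_disjointPaths_succ {t N : ℕ} {d : ℤ} {p q : Fin t → ℤ × ℤ}
    (hp : ∀ a, (p a).1 + (p a).2 = d) (hinj : Function.Injective p)
    (f : (Fin t → List (ℤ × ℤ)) → F) :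
    ∑ L ∈ disjointPaths (N + 1) p q, f L = ∑ ε : Fin t → Bool,
      ∑ L ∈ disjointPaths N (fun a => p a + unitStep (ε a)) q, f fun a => p a :: L a := by
  rw [Finset.sum_sigma']
  symm
  refine Finset.sum_bij (fun x _ a => p a :: x.2 a) ?_ ?_ ?_ ?_
  · rintro ⟨ε, L⟩ h
    have hL := (Finset.mem_sigma.mp h).2
    exact (cons_mem_disjointPaths ε hp hinj (mem_disjointPaths.mp hL).1).mpr hL
  · rintro ⟨ε, L⟩ h ⟨ε', L'⟩ h' hLL
    have hL := (mem_disjointPaths.mp (Finset.mem_sigma.mp h).2).1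
    have hL' := (mem_disjointPaths.mp (Finset.mem_sigma.mp h').2).1
    have e1 : L = L' := by
      funext a
      exact (List.cons.inj (congrFun hLL a)).2
    subst e1
    have e2 : ε = ε' := by
      funext a
      obtain ⟨T, hT⟩ := head_of_mem_latticePaths (hL a)
      obtain ⟨T', hT'⟩ := head_of_mem_latticePaths (hL' a)
      simp only at hT hT'
      have h5 := (List.cons.inj (hT.symm.trans hT')).1
      have h6 : unitStep (ε a) = unitStep (ε' a) := add_left_cancel h5
      revert h6
      cases ε a <;> cases ε' a <;> simp [unitStep]
    rw [e2]
  · intro L hL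
    have h1 := (mem_disjointPaths.mp hL).1
    choose ε L' hL' hc using fun a => mem_latticePaths_succ.mp (h1 a)
    obtain rfl : (fun a => p a :: L' a) = L := funext hc
    exact ⟨⟨ε, L'⟩, Finset.mem_sigma.mpr ⟨Finset.mem_univ _,
      (cons_mem_disjointPaths ε hp hinj hL').mp hL⟩, rfl⟩
  · intro x _
    rfl

/-- The Lindström–Gessel–Viennot formula for points on two antidiagonals. -/
theorem sum_disjointPaths (w : ℤ → ℤ → F) {t N : ℕ} {d : ℤ} {p q : Fin t → ℤ × ℤ}
    (hp : ∀ a, (p a).1 + (p a).2 = d) (hq : ∀ a, (q a).1 + (q a).2 = d + N)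
    (hpa : StrictAnti fun a => (p a).1) (hqa : StrictAnti fun a => (q a).1) :
    ∑ L ∈ disjointPaths N p q, ∏ a, ((L a).map fun v => w v.1 v.2).prod =
      Matrix.det (Matrix.of fun a b => greens w (p a).1 (p a).2 (q b).1 (q b).2) := by
  -- Induction on the length replaces the sign-reversing involution: multilinearity in the rows
  -- expands the determinant over all choices of first steps.
  induction N generalizing p d with
  | zero =>
    have hmem : ∀ L, L ∈ disjointPaths 0 p q → ∀ a, L a = [p a] := by
      intro L hL a
      simpa [latticePaths] using (mem_disjointPaths.mp hL).1 a
    have hqinj : Function.Injective q := fun a b hab => hqa.injective (congrArg Prod.fst hab)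
    have hpinj : Function.Injective p := fun a b hab => hpa.injective (congrArg Prod.fst hab)
    by_cases hpq : p = q
    · subst hpq
      have h1 : disjointPaths 0 p p = {fun a => [p a]} := by
        ext L
        rw [Finset.mem_singleton]
        refine ⟨fun h => funext (hmem L h), ?_⟩
        rintro rfl
        refine mem_disjointPaths.mpr ⟨fun a => by simp [latticePaths], ⟨1, by simp⟩, ?_⟩
        intro a b hab
        have : p a ≠ p b := fun h => hab (hpinj h)
        simpa using this.symm
      have h2 : (Matrix.of fun a b => greens w (p a).1 (p a).2 (p b).1 (p b).2) =
          Matrix.diagonal fun a => w (p a).1 (p a).2 := by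
        ext a b
        rw [Matrix.of_apply, Matrix.diagonal_apply]
        split_ifs with hab
        · rw [hab, greens_self]
        · refine greens_eq_zero_of_level w (by rw [hp, hp]) fun h => hab (hpinj (Prod.ext h.1 h.2))
      rw [h1, h2, Matrix.det_diagonal]
      simp
    -- If every source were a sink, the matching would be a strictly increasing self-map of `Fin t`,
    -- hence the identity. A source that is no sink makes both sides zero.
    · have h3 : ∃ a, ∀ b, p a ≠ q b := by
        by_contra hcon
        push Not at hcon
        choose f hf using hcon
        have hmono : StrictMono f := by
          intro a b hab
          have h4 := hpa hab
          simp only [hf] at h4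
          exact hqa.lt_iff_gt.mp h4
        have : f = id := funext fun a => le_antisymm hmono.apply_le hmono.le_apply
        exact hpq (funext fun a => by rw [hf a, this]; rfl)
      obtain ⟨a, ha⟩ := h3
      rw [Matrix.det_eq_zero_of_row_eq_zero a]
      · refine Finset.sum_eq_zero fun L hL => ?_
        obtain ⟨σ, hσ⟩ := (mem_disjointPaths.mp hL).2.1
        have h5 := hσ a
        rw [hmem L hL a] at h5
        simp only [List.getLast?_singleton, Option.some.injEq] at h5
        exact absurd h5 (ha _)
      · intro b
        refine greens_eq_zero_of_level w (by rw [hp, hq]; simp) fun h => ha b (Prod.ext h.1 h.2)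
  | succ N ih =>
    have hpinj : Function.Injective p := fun a b hab => hpa.injective (congrArg Prod.fst hab)
    rw [sum_disjointPaths_succ hp hpinj]
    have h1 : ∀ ε : Fin t → Bool, ∑ L ∈ disjointPaths N (fun a => p a + unitStep (ε a)) q,
        ∏ a, ((p a :: L a).map fun v => w v.1 v.2).prod =
        (∏ a, w (p a).1 (p a).2) * Matrix.det (Matrix.of fun a b =>
          greens w (p a + unitStep (ε a)).1 (p a + unitStep (ε a)).2 (q b).1 (q b).2) := by
      intro ε
      have h2 : ∀ L : Fin t → List (ℤ × ℤ), ∏ a, ((p a :: L a).map fun v => w v.1 v.2).prod =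
          (∏ a, w (p a).1 (p a).2) * ∏ a, ((L a).map fun v => w v.1 v.2).prod := by
        intro L
        rw [← Finset.prod_mul_distrib]
        simp
      rw [Finset.sum_congr rfl fun L _ => h2 L, ← Finset.mul_sum]
      congr 1
      -- A step changes the first coordinate by 0 or 1, so distinct new points keep their order. If
      -- two of them coincide, the determinant has equal rows and no family is disjoint.
      by_cases hinj : Function.Injective fun a => p a + unitStep (ε a)
      · refine ih (d := d + 1) ?_ ?_ ?_
        · intro a
          rw [unitStep_level, hp]
        · intro a
          rw [hq]
          push_cast
          ring
        · intro a b hab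
          have h3 := hpa hab
          have h4 := unitStep_fst (p a) (ε a)
          have h5 := unitStep_fst (p b) (ε b)
          have h6 : (p a + unitStep (ε a)).1 ≠ (p b + unitStep (ε b)).1 := by
            intro h6
            refine hab.ne (hinj (Prod.ext h6 ?_))
            have h7 := unitStep_level (p a) (ε a)
            have h8 := unitStep_level (p b) (ε b)
            have h9 := hp a
            have h10 := hp b
            simp only
            omega
          simp only at h3 ⊢
          omega
      · simp only [Function.Injective, not_forall] at hinj
        obtain ⟨a, b, hab, hne⟩ := hinj
        rw [Matrix.det_zero_of_row_eq hne (by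
          funext c
          simp only [Matrix.of_apply]
          rw [hab])]
        refine Finset.sum_eq_zero fun L hL => ?_
        obtain ⟨hL1, _, hL2⟩ := mem_disjointPaths.mp hL
        obtain ⟨T, hT⟩ := head_of_mem_latticePaths (hL1 a)
        obtain ⟨T', hT'⟩ := head_of_mem_latticePaths (hL1 b)
        have h3 := hL2 a b hne
        rw [hT, hT'] at h3
        rw [hab] at h3
        exact absurd h3 (by simp)
    rw [Finset.sum_congr rfl fun ε _ => h1 ε, ← Finset.mul_sum]
    have h2 : (Matrix.of fun a b => greens w (p a).1 (p a).2 (q b).1 (q b).2) =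
        Matrix.of fun a b => w (p a).1 (p a).2 * (Matrix.of fun a => ∑ ε : Bool, fun b =>
          greens w (p a + unitStep ε).1 (p a + unitStep ε).2 (q b).1 (q b).2) a b := by
      ext a b
      simp only [Matrix.of_apply]
      rw [greens_step w (by have := hp a; have := hq b; push_cast at this; omega)]
      simp [unitStep]
    rw [h2, Matrix.det_mul_column]
    congr 1
    exact ((Matrix.detRowAlternating (n := Fin t) (R := F)).toMultilinearMap.map_sum
      (fun a ε b => greens w (p a + unitStep ε).1 (p a + unitStep ε).2 (q b).1 (q b).2)).symm

end LatticePaths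

/-! ### The polynomials φ as path determinants. -/

section PhiEvaluation

variable {F : Type*} [Field F]

/-- `N` is the difference of the levels of sinks and sources. Paths between these antidiagonals stay
in the hexagon automatically. -/
theorem mem_nilpFamilies_iff {r s t N : ℕ} {m n : ℤ} (hN : (N : ℤ) = r + s - m - n + 2 - 2 * t)
    {L : Fin t → List (ℤ × ℤ)} :
    L ∈ nilpFamilies r s t m n ↔ L ∈ disjointPaths N (source m n) (sink r s) := by
  rw [mem_disjointPaths]
  have hsink : ∀ a : Fin t, (sink r s a).1 + (sink r s a).2 = m + n + t - 1 + N := by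
    intro a; simp only [sink]; omega
  have hsource : ∀ a : Fin t, (source m n a).1 + (source m n a).2 = m + n + t - 1 := by
    intro a; simp only [source]; omega
  constructor
  · rintro ⟨h1, -, h2, ⟨σ, h3⟩, h4⟩
    refine ⟨fun a => ?_, ⟨σ, h3⟩, h4⟩
    obtain ⟨T, hT⟩ : ∃ T, L a = source m n a :: T := by
      have := h2 a
      cases hL : L a with
      | nil => rw [hL] at this; simp at this
      | cons x T =>
        rw [hL] at this
        simp only [List.head?_cons, Option.some.injEq] at this
        exact ⟨T, by rw [this]⟩
    have h5 : L a ∈ latticePaths T.length (source m n a) := by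
      have := h1 a
      rw [hT] at this ⊢
      exact mem_latticePaths_of_isLatticePath this
    have h6 := level_last_of_mem_latticePaths h5 (h3 a)
    rw [hsink, hsource] at h6
    have h7 : T.length = N := by omega
    rwa [h7] at h5
  · rintro ⟨h1, ⟨σ, h3⟩, h4⟩
    refine ⟨fun a => isLatticePath_of_mem (h1 a), fun a v hv => ?_, fun a => ?_, ⟨σ, h3⟩, h4⟩
    · have h5 := ge_of_mem_latticePaths (h1 a) hv
      have h6 := le_last_of_mem_latticePaths (h1 a) (h3 a) hv
      have ha := a.2
      have hb := (σ a).2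
      simp only [source, sink] at h5 h6
      simp only [hexagon, Finset.mem_filter, Finset.mem_product, Finset.mem_Icc]
      omega
    · obtain ⟨T, hT⟩ := head_of_mem_latticePaths (h1 a)
      rw [hT, List.head?_cons]

theorem det_pathMatrix (w : ℤ → ℤ → F) {r s t : ℕ} {m n : ℤ}
    (h : 2 * (t : ℤ) ≤ r + s - m - n + 2) :
    (pathMatrix w t m n r s).det = ∑ L ∈ (nilpFamilies_finite r s t m n).toFinset,
      ∏ a, ((L a).map fun v => w v.1 v.2).prod := by
  obtain ⟨N, hN⟩ : ∃ N : ℕ, (N : ℤ) = r + s - m - n + 2 - 2 * t :=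
    ⟨(r + s - m - n + 2 - 2 * t : ℤ).toNat, by omega⟩
  have h1 : (nilpFamilies_finite r s t m n).toFinset =
      disjointPaths N (source m n) (sink r s) := by
    ext L
    rw [Set.Finite.mem_toFinset, mem_nilpFamilies_iff hN]
  rw [h1, sum_disjointPaths w (d := m + n + t - 1)]
  · rfl
  · intro a; simp only [source]; omega
  · intro a; simp only [sink]; omega
  · intro a b hab
    have : (a : ℕ) < b := hab
    simp only [source]; omega
  · intro a b hab
    have : (a : ℕ) < b := hab
    simp only [sink]; omega

/-- The product of the variables off the paths is the product over the hexagon divided by the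
product along the paths, so each path vertex receives weight 1/A. -/
theorem ringHom_phi_eq (ev : MvPolynomial (ℤ × ℤ) ℤ →+* F) {r s t : ℕ} {m n : ℤ}
    (hA : ∀ p ∈ hexagon r s t m n, ev (MvPolynomial.X p) ≠ 0)
    (h : 2 * (t : ℤ) ≤ r + s - m - n + 2) :
    ev (phi r s t m n) = (∏ p ∈ hexagon r s t m n, ev (MvPolynomial.X p)) *
      (pathMatrix (fun u v => (ev (MvPolynomial.X (u, v)))⁻¹) t m n r s).det := by
  classical
  rw [det_pathMatrix _ h, Finset.mul_sum, phi, map_sum]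
  refine Finset.sum_congr rfl fun L hL => ?_
  rw [Set.Finite.mem_toFinset] at hL
  obtain ⟨h1, h2, -, -, h3⟩ := hL
  rw [map_prod]
  have e1 : ∀ a, ((L a).map fun v => (ev (MvPolynomial.X (v.1, v.2)))⁻¹).prod =
      (∏ p ∈ (L a).toFinset, ev (MvPolynomial.X p))⁻¹ := by
    intro a
    rw [← Finset.prod_inv_distrib, List.prod_toFinset _ (h1 a).nodup]
  have e2 : ∏ a, ∏ p ∈ (L a).toFinset, ev (MvPolynomial.X p) =
      ∏ p ∈ (hexagon r s t m n).filter (fun p => ¬∀ a, p ∉ L a), ev (MvPolynomial.X p) := by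
    rw [← Finset.prod_biUnion]
    · refine Finset.prod_congr ?_ fun _ _ => rfl
      ext p
      simp only [Finset.mem_biUnion, Finset.mem_univ, true_and, List.mem_toFinset,
        Finset.mem_filter, not_forall, not_not]
      exact ⟨fun ⟨a, ha⟩ => ⟨h2 a p ha, a, ha⟩, fun h => h.2⟩
    · intro a _ b _ hab
      rw [Function.onFun, Finset.disjoint_left]
      intro x hx hx'
      exact h3 a b hab (List.mem_toFinset.mp hx) (List.mem_toFinset.mp hx')
  simp only [e1]
  rw [Finset.prod_inv_distrib, e2,
    ← Finset.prod_filter_mul_prod_filter_not (hexagon r s t m n) (fun p => ∀ a, p ∉ L a)]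
  have h0 : ∏ p ∈ (hexagon r s t m n).filter (fun p => ¬∀ a, p ∉ L a), ev (MvPolynomial.X p) ≠ 0 :=
    Finset.prod_ne_zero_iff.mpr fun p hp => hA p (Finset.mem_filter.mp hp).1
  rw [mul_assoc, mul_inv_cancel₀ h0, mul_one]

theorem staircaseProd_eq_prod (t : ℕ) (c : ℕ → ℕ → F) : staircaseProd t c =
    ∏ p ∈ (Finset.range t ×ˢ Finset.range t).filter (fun p => p.2 + p.1 + 2 ≤ t), c p.2 p.1 := by
  rw [Finset.prod_filter, Finset.prod_product]
  rfl

/-- The bounds on `t` make the two corners cut off by the hexagon complete and disjoint staircases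
inside the rectangle. -/
theorem prod_hexagon (A : ℤ × ℤ → F) {r s t : ℕ} {m n : ℤ} (hr : (t : ℤ) ≤ r - m + 1)
    (hs : (t : ℤ) ≤ s - n + 1) :
    ∏ p ∈ Finset.Icc m (r : ℤ) ×ˢ Finset.Icc n (s : ℤ), A p =
      (∏ p ∈ hexagon r s t m n, A p) * staircaseProd t (fun i a => A (m + i, n + a)) *
        staircaseProd t (fun i a => A (r - i, s - a)) := by
  classical
  rw [← Finset.prod_filter_mul_prod_filter_not _
      (fun p => m + n + t - 1 ≤ p.1 + p.2 ∧ p.1 + p.2 ≤ (r : ℤ) + s - t + 1),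
    ← Finset.prod_filter_mul_prod_filter_not (Finset.filter (fun p : ℤ × ℤ =>
        ¬(m + n + t - 1 ≤ p.1 + p.2 ∧ p.1 + p.2 ≤ (r : ℤ) + s - t + 1)) _)
      (fun p => p.1 + p.2 < m + n + t - 1), mul_assoc, staircaseProd_eq_prod, staircaseProd_eq_prod]
  congr 1
  congr 1
  · symm
    refine Finset.prod_bij (fun (p : ℕ × ℕ) _ => (m + (p.2 : ℤ), n + (p.1 : ℤ))) ?_ ?_ ?_ ?_
    · rintro ⟨x, y⟩ hp
      simp only [Finset.mem_filter, Finset.mem_product, Finset.mem_range, Finset.mem_Icc] at hp ⊢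
      omega
    · rintro ⟨x, y⟩ _ ⟨x', y'⟩ _ hxy
      simp only [Prod.mk.injEq] at hxy ⊢
      omega
    · rintro ⟨x, y⟩ hp
      simp only [Finset.mem_filter, Finset.mem_product, Finset.mem_Icc] at hp
      refine ⟨((y - n).toNat, (x - m).toNat), ?_, ?_⟩
      · simp only [Finset.mem_filter, Finset.mem_product, Finset.mem_range]
        omega
      · simp only [Prod.mk.injEq]
        omega
    · intro p _
      rfl
  · symm
    refine Finset.prod_bij (fun (p : ℕ × ℕ) _ => (r - (p.2 : ℤ), s - (p.1 : ℤ))) ?_ ?_ ?_ ?_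
    · rintro ⟨x, y⟩ hp
      simp only [Finset.mem_filter, Finset.mem_product, Finset.mem_range, Finset.mem_Icc] at hp ⊢
      omega
    · rintro ⟨x, y⟩ _ ⟨x', y'⟩ _ hxy
      simp only [Prod.mk.injEq] at hxy ⊢
      omega
    · rintro ⟨x, y⟩ hp
      simp only [Finset.mem_filter, Finset.mem_product, Finset.mem_Icc] at hp
      refine ⟨((s - y).toNat, (r - x).toNat), ?_, ?_⟩
      · simp only [Finset.mem_filter, Finset.mem_product, Finset.mem_range]
        omega
      · simp only [Prod.mk.injEq]
        omega
    · intro p _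
      rfl

theorem staircaseProd_inv (t : ℕ) (c : ℕ → ℕ → F) :
    staircaseProd t (fun i a => (c i a)⁻¹) = (staircaseProd t c)⁻¹ := by
  rw [staircaseProd_eq_prod, staircaseProd_eq_prod, Finset.prod_inv_distrib]

/-- The value of `φ_t(m,n)` at nonzero arguments. -/
theorem ringHom_phi (ev : MvPolynomial (ℤ × ℤ) ℤ →+* F) {r s t : ℕ} {m n : ℤ}
    (hA : ∀ p ∈ Finset.Icc m (r : ℤ) ×ˢ Finset.Icc n (s : ℤ), ev (MvPolynomial.X p) ≠ 0)
    (hr : (t : ℤ) ≤ r - m + 1) (hs : (t : ℤ) ≤ s - n + 1) :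
    ev (phi r s t m n) =
      (∏ p ∈ Finset.Icc m (r : ℤ) ×ˢ Finset.Icc n (s : ℤ), ev (MvPolynomial.X p)) *
        pathDet (fun u v => (ev (MvPolynomial.X (u, v)))⁻¹) t m n r s := by
  rw [ringHom_phi_eq ev (fun p hp => hA p (Finset.mem_filter.mp hp).1) (by omega), pathDet,
    staircaseProd_inv t (fun i a => ev (MvPolynomial.X (m + i, n + a))),
    staircaseProd_inv t (fun i a => ev (MvPolynomial.X (r - i, s - a)))]
  have h0 := Finset.prod_ne_zero_iff.mpr hA
  rw [prod_hexagon (fun p => ev (MvPolynomial.X p)) hr hs] at h0 ⊢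
  have h1 := right_ne_zero_of_mul h0
  have h2 := right_ne_zero_of_mul (left_ne_zero_of_mul h0)
  field_simp

end PhiEvaluation

/-! ### Toggles in integer coordinates. -/

section Labelings

variable {F : Type*} [Field F] {r s : ℕ}

/-- The labels of the rectangle, extended by `0` to all integer points. -/
def label (f : PHat (Rect r s) → F) (u v : ℤ) : F :=
  if h : (0 ≤ u ∧ u ≤ r) ∧ (0 ≤ v ∧ v ≤ s) then
    f (toHat (⟨u.toNat, by omega⟩, ⟨v.toNat, by omega⟩))
  else 0

theorem label_coe (f : PHat (Rect r s) → F) (i : Fin (r + 1)) (j : Fin (s + 1)) :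
    label f (i : ℕ) (j : ℕ) = f (toHat (i, j)) := by
  rw [label, dif_pos (by omega)]
  simp

theorem label_of_not_mem (f : PHat (Rect r s) → F) {u v : ℤ}
    (h : ¬((0 ≤ u ∧ u ≤ r) ∧ (0 ≤ v ∧ v ≤ s))) : label f u v = 0 :=
  dif_neg h

theorem exists_label_eq (f : PHat (Rect r s) → F) {u v : ℤ}
    (h : (0 ≤ u ∧ u ≤ r) ∧ (0 ≤ v ∧ v ≤ s)) :
    ∃ p : Rect r s, ((p.1 : ℕ) : ℤ) = u ∧ ((p.2 : ℕ) : ℤ) = v ∧ label f u v = f (toHat p) :=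
  ⟨(⟨u.toNat, by omega⟩, ⟨v.toNat, by omega⟩), by simp only; omega, by simp only; omega,
    dif_pos h⟩

/-- The sum of the labels of the elements covered by `(u, v)`. -/
def lowerSum (f : PHat (Rect r s) → F) (u v : ℤ) : F :=
  if u = 0 ∧ v = 0 then f ⊥ else label f (u - 1) v + label f u (v - 1)

/-- The sum of the inverses of the labels of the elements covering `(u, v)`. -/
def upperSum (f : PHat (Rect r s) → F) (u v : ℤ) : F :=
  if u = r ∧ v = s then (f (WithBot.some ⊤))⁻¹ else (label f (u + 1) v)⁻¹ + (label f u (v + 1))⁻¹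

theorem toHat_injective {P : Type*} : Function.Injective (toHat : P → PHat P) :=
  fun _ _ h => WithTop.coe_injective (WithBot.coe_injective h)

theorem toHat_covBy_toHat {P : Type*} [PartialOrder P] {p q : P} :
    toHat p ⋖ toHat q ↔ p ⋖ q :=
  WithBot.coe_covBy_coe.trans WithTop.coe_covBy_coe

theorem bot_covBy_toHat {P : Type*} [PartialOrder P] {p : P} : ⊥ ⋖ toHat p ↔ IsMin p := by
  rw [toHat, WithBot.bot_covBy_coe]
  constructor
  · intro h q hq
    exact WithTop.coe_le_coe.mp (h (WithTop.coe_le_coe.mpr hq))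
  · intro h q hq
    cases q with
    | top => exact absurd hq (by simp)
    | coe q => exact WithTop.coe_le_coe.mpr (h (WithTop.coe_le_coe.mp hq))

theorem toHat_covBy_top {P : Type*} [PartialOrder P] {p : P} :
    toHat p ⋖ (WithBot.some ⊤ : PHat P) ↔ IsMax p :=
  WithBot.coe_covBy_coe.trans WithTop.coe_covBy_top

theorem rect_covBy {p q : Rect r s} : p ⋖ q ↔
    ((p.1 : ℕ) + 1 = q.1 ∧ (p.2 : ℕ) = q.2) ∨ ((p.1 : ℕ) = q.1 ∧ (p.2 : ℕ) + 1 = q.2) := by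
  rw [Prod.covBy_iff, Fin.covBy_iff, Fin.covBy_iff, Nat.covBy_iff_add_one_eq,
    Nat.covBy_iff_add_one_eq, Fin.ext_iff, Fin.ext_iff]
  omega

theorem rect_isMin {p : Rect r s} : IsMin p ↔ (p.1 : ℕ) = 0 ∧ (p.2 : ℕ) = 0 := by
  constructor
  · intro h
    have := h (b := (0, 0)) ⟨Fin.zero_le _, Fin.zero_le _⟩
    exact ⟨Nat.le_zero.mp this.1, Nat.le_zero.mp this.2⟩
  · rintro ⟨h1, h2⟩ q hq
    refine ⟨Fin.le_def.mpr ?_, Fin.le_def.mpr ?_⟩ <;> omega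

theorem rect_isMax {p : Rect r s} : IsMax p ↔ (p.1 : ℕ) = r ∧ (p.2 : ℕ) = s := by
  constructor
  · intro h
    have := h (b := (Fin.last r, Fin.last s)) ⟨Fin.le_last _, Fin.le_last _⟩
    have h1 : r ≤ p.1 := this.1
    have h2 : s ≤ p.2 := this.2
    omega
  · rintro ⟨h1, h2⟩ q hq
    refine ⟨Fin.le_def.mpr ?_, Fin.le_def.mpr ?_⟩ <;> omega

theorem sum_ite_label (f : PHat (Rect r s) → F) (u v : ℤ) :
    ∑ q : Rect r s, (if ((q.1 : ℕ) : ℤ) = u ∧ ((q.2 : ℕ) : ℤ) = v then f (toHat q) else 0) =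
      label f u v := by
  by_cases h : (0 ≤ u ∧ u ≤ r) ∧ (0 ≤ v ∧ v ≤ s)
  · obtain ⟨p, rfl, rfl, hp⟩ := exists_label_eq f h
    rw [hp, Finset.sum_eq_single p]
    · simp
    · intro q _ hq
      refine if_neg fun hh => hq (Prod.ext ?_ ?_) <;> ext <;> omega
    · simp
  · rw [label_of_not_mem f h]
    refine Finset.sum_eq_zero fun q _ => if_neg ?_
    omega

theorem sum_PHat {P : Type*} [Fintype P] (f : PHat P → F) :
    ∑ w, f w = f ⊥ + (f (WithBot.some ⊤) + ∑ q, f (toHat q)) := by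
  have h1 : ∑ w : PHat P, f w = f ⊥ + ∑ w : WithTop P, f (WithBot.some w) :=
    Fintype.sum_option (fun w : Option (WithTop P) => f w)
  have h2 : ∑ w : WithTop P, f (WithBot.some w) =
      f (WithBot.some ⊤) + ∑ q, f (WithBot.some (WithTop.some q)) :=
    Fintype.sum_option (fun w : Option P => f (WithBot.some w))
  rw [h1, h2]
  rfl

open Classical in
theorem sum_covered (f : PHat (Rect r s) → F) (p : Rect r s) :
    ∑ w ∈ Finset.univ.filter (fun w : PHat (Rect r s) => w ⋖ toHat p), f w =
      lowerSum f (p.1 : ℕ) (p.2 : ℕ) := by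
  rw [Finset.sum_filter, sum_PHat]
  have h0 : ¬(WithBot.some ⊤ : PHat (Rect r s)) ⋖ toHat p := fun h =>
    absurd h.lt (WithBot.coe_le_coe.mpr le_top).not_gt
  rw [if_neg h0, zero_add]
  simp only [bot_covBy_toHat, rect_isMin, toHat_covBy_toHat, rect_covBy]
  have h1 : ∀ q : Rect r s, (if ((q.1 : ℕ) + 1 = p.1 ∧ (q.2 : ℕ) = p.2) ∨
      ((q.1 : ℕ) = p.1 ∧ (q.2 : ℕ) + 1 = p.2) then f (toHat q) else 0) =
      (if ((q.1 : ℕ) : ℤ) = (p.1 : ℕ) - 1 ∧ ((q.2 : ℕ) : ℤ) = (p.2 : ℕ) then f (toHat q) else 0) +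
      (if ((q.1 : ℕ) : ℤ) = (p.1 : ℕ) ∧ ((q.2 : ℕ) : ℤ) = (p.2 : ℕ) - 1 then f (toHat q) else 0) := by
    intro q
    split_ifs <;> first | omega | simp
  rw [Finset.sum_congr rfl fun q _ => h1 q, Finset.sum_add_distrib, sum_ite_label, sum_ite_label,
    lowerSum]
  by_cases h : (p.1 : ℕ) = 0 ∧ (p.2 : ℕ) = 0
  · rw [if_pos h, if_pos (by omega), label_of_not_mem f (by omega), label_of_not_mem f (by omega)]
    simp
  · rw [if_neg h, if_neg (by omega), zero_add]

-- A missing upper neighbour has label 0, and `0⁻¹ = 0` removes it from the sum.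
open Classical in
theorem sum_covering (f : PHat (Rect r s) → F) (p : Rect r s) :
    ∑ z ∈ Finset.univ.filter (fun z : PHat (Rect r s) => toHat p ⋖ z), 1 / f z =
      upperSum f (p.1 : ℕ) (p.2 : ℕ) := by
  rw [Finset.sum_filter, sum_PHat]
  have h0 : ¬toHat p ⋖ (⊥ : PHat (Rect r s)) := fun h => absurd h.lt (not_lt_bot)
  rw [if_neg h0, zero_add]
  simp only [toHat_covBy_top, rect_isMax, toHat_covBy_toHat, rect_covBy]
  have h1 : ∀ q : Rect r s, (if ((p.1 : ℕ) + 1 = q.1 ∧ (p.2 : ℕ) = q.2) ∨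
      ((p.1 : ℕ) = q.1 ∧ (p.2 : ℕ) + 1 = q.2) then 1 / f (toHat q) else 0) =
      (if ((q.1 : ℕ) : ℤ) = (p.1 : ℕ) + 1 ∧ ((q.2 : ℕ) : ℤ) = (p.2 : ℕ) then
        (fun z => 1 / f z) (toHat q) else 0) +
      (if ((q.1 : ℕ) : ℤ) = (p.1 : ℕ) ∧ ((q.2 : ℕ) : ℤ) = (p.2 : ℕ) + 1 then
        (fun z => 1 / f z) (toHat q) else 0) := by
    intro q
    split_ifs <;> first | omega | simp
  have h2 : ∀ u v, label (fun z => 1 / f z) u v = (label f u v)⁻¹ := by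
    intro u v
    by_cases h : (0 ≤ u ∧ u ≤ r) ∧ (0 ≤ v ∧ v ≤ s)
    · rw [label, label, dif_pos h, dif_pos h, one_div]
    · rw [label_of_not_mem _ h, label_of_not_mem _ h, inv_zero]
  rw [Finset.sum_congr rfl fun q _ => h1 q, Finset.sum_add_distrib,
    sum_ite_label (fun z => 1 / f z), sum_ite_label (fun z => 1 / f z), upperSum, h2, h2]
  by_cases h : (p.1 : ℕ) = r ∧ (p.2 : ℕ) = s
  · rw [if_pos h, if_pos (by omega), label_of_not_mem f (by omega), label_of_not_mem f (by omega)]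
    simp
  · rw [if_neg h, if_neg (by omega), zero_add]

theorem toggle_apply_self (f : PHat (Rect r s) → F) (p : Rect r s) :
    toggle p f (toHat p) = 1 / f (toHat p) *
      (lowerSum f (p.1 : ℕ) (p.2 : ℕ) / upperSum f (p.1 : ℕ) (p.2 : ℕ)) := by
  rw [toggle, if_pos rfl, sum_covered, sum_covering]

theorem toggle_apply_of_ne {P : Type*} [PartialOrder P] [Fintype P] (f : PHat P → F) {p : P}
    {y : PHat P} (h : y ≠ toHat p) : toggle p f y = f y := by
  rw [toggle, if_neg h]

end Labelings

/-! ### The local rule of rowmotion along a linear extension. -/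

section Rowmotion

variable {F : Type*} [Field F]

open Classical in
/-- After toggling along a list that is sorted and contains no element twice, each listed label is
given by the old labels below and the new labels above. -/
theorem foldr_toggle_apply {P : Type*} [PartialOrder P] [Fintype P] (l : List P) (hnd : l.Nodup)
    (hs : l.Pairwise (fun a b => ¬ b < a)) (f : PHat P → F) :
    (∀ y, (∀ p ∈ l, y ≠ toHat p) → rowmotion l f y = f y) ∧
      ∀ p ∈ l, rowmotion l f (toHat p) =
        1 / f (toHat p) *
          ((∑ w ∈ Finset.univ.filter (fun w : PHat P => w ⋖ toHat p), f w) /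
            (∑ z ∈ Finset.univ.filter (fun z : PHat P => toHat p ⋖ z), 1 / rowmotion l f z)) := by
  induction l with
  | nil => simp [rowmotion]
  | cons v l ih =>
    obtain ⟨hv, hnd⟩ := List.nodup_cons.mp hnd
    obtain ⟨hlt, hs⟩ := List.pairwise_cons.mp hs
    obtain ⟨ih1, ih2⟩ := ih hnd hs
    have hr : rowmotion (v :: l) f = toggle v (rowmotion l f) := rfl
    have hne : ∀ p ∈ l, toHat p ≠ toHat v := by
      rintro p hp h
      rw [toHat_injective h] at hp
      exact hv hp
    refine ⟨fun y hy => ?_, fun p hp => ?_⟩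
    · rw [hr, toggle_apply_of_ne _ (hy v List.mem_cons_self)]
      exact ih1 y fun p hp => hy p (List.mem_cons_of_mem _ hp)
    · rw [hr]
      rcases List.mem_cons.mp hp with rfl | hp
      · rw [toggle, if_pos rfl, ih1 _ fun q hq => (hne q hq).symm]
        congr 2
        · refine Finset.sum_congr rfl fun w hw => ih1 w ?_
          rintro q hq rfl
          exact hlt q hq (toHat_covBy_toHat.mp (Finset.mem_filter.mp hw).2).lt
        · refine Finset.sum_congr rfl fun z hz => ?_
          rw [toggle_apply_of_ne]
          rintro rfl
          exact absurd (Finset.mem_filter.mp hz).2.lt (lt_irrefl _)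
      · rw [toggle_apply_of_ne _ (hne p hp), ih2 p hp]
        congr 2
        refine Finset.sum_congr rfl fun z hz => ?_
        rw [toggle_apply_of_ne]
        rintro rfl
        exact hlt p hp (toHat_covBy_toHat.mp (Finset.mem_filter.mp hz).2).lt

end Rowmotion

/-! ### Genericity of labelings and its preservation. -/

section Generic

variable {F : Type*} [Field F] {r s : ℕ}

theorem rowmotion_apply {l : List (Rect r s)} (hl : IsLinearExtension l)
    (f : PHat (Rect r s) → F) (p : Rect r s) :
    rowmotion l f (toHat p) = 1 / f (toHat p) *
      (lowerSum f (p.1 : ℕ) (p.2 : ℕ) / upperSum (rowmotion l f) (p.1 : ℕ) (p.2 : ℕ)) := by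
  rw [(foldr_toggle_apply l hl.nodup hl.sorted f).2 p (hl.mem_all p), sum_covered, sum_covering]

/-- A labeling whose labels in the rectangle are algebraically independent, and whose two
adjoined labels are `1`. -/
structure IsGeneric (K : Type*) [Field K] [Algebra K F] (f : PHat (Rect r s) → F) : Prop where
  bot : f ⊥ = 1
  top : f (WithBot.some ⊤) = 1
  indep : AlgebraicIndependent K fun p => f (toHat p)

variable {K : Type*} [Field K] [Algebra K F]

theorem IsGeneric.ne_zero {f : PHat (Rect r s) → F} (hf : IsGeneric K f) (p : Rect r s) :
    f (toHat p) ≠ 0 :=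
  hf.indep.ne_zero p

theorem IsGeneric.label_ne_zero {f : PHat (Rect r s) → F} (hf : IsGeneric K f) {u v : ℤ}
    (h : (0 ≤ u ∧ u ≤ r) ∧ (0 ≤ v ∧ v ≤ s)) : label f u v ≠ 0 := by
  obtain ⟨p, -, -, hp⟩ := exists_label_eq f h
  rw [hp]
  exact hf.ne_zero p

theorem IsGeneric.add_ne_zero {f : PHat (Rect r s) → F} (hf : IsGeneric K f) {p q : Rect r s}
    (h : p ≠ q) : f (toHat p) + f (toHat q) ≠ 0 := by
  intro h0
  have h1 : f (toHat p) = -f (toHat q) := eq_neg_of_add_eq_zero_left h0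
  refine (AlgebraicIndependent.iff_transcendental_adjoin_image p |>.mp hf.indep).2 ?_
  rw [h1]
  exact (isAlgebraic_algebraMap (⟨f (toHat q), Algebra.subset_adjoin ⟨q, h.symm, rfl⟩⟩ :
    Algebra.adjoin K ((fun p => f (toHat p)) '' {p}ᶜ))).neg

theorem IsGeneric.label_add_ne_zero {f : PHat (Rect r s) → F} (hf : IsGeneric K f) {u v u' v' : ℤ}
    (hne : ¬(u = u' ∧ v = v'))
    (h : ((0 ≤ u ∧ u ≤ r) ∧ (0 ≤ v ∧ v ≤ s)) ∨ ((0 ≤ u' ∧ u' ≤ r) ∧ (0 ≤ v' ∧ v' ≤ s))) :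
    label f u v + label f u' v' ≠ 0 := by
  by_cases h1 : (0 ≤ u ∧ u ≤ r) ∧ (0 ≤ v ∧ v ≤ s)
  · by_cases h2 : (0 ≤ u' ∧ u' ≤ r) ∧ (0 ≤ v' ∧ v' ≤ s)
    · obtain ⟨p, hp1, hp2, hp⟩ := exists_label_eq f h1
      obtain ⟨q, hq1, hq2, hq⟩ := exists_label_eq f h2
      rw [hp, hq]
      refine hf.add_ne_zero fun hpq => hne ?_
      subst hpq
      omega
    · rw [label_of_not_mem f h2, add_zero]
      exact hf.label_ne_zero h1
  · rw [label_of_not_mem f h1, zero_add]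
    exact hf.label_ne_zero (h.resolve_left h1)

theorem IsGeneric.lowerSum_ne_zero {f : PHat (Rect r s) → F} (hf : IsGeneric K f) {u v : ℤ}
    (h : (0 ≤ u ∧ u ≤ r) ∧ (0 ≤ v ∧ v ≤ s)) : lowerSum f u v ≠ 0 := by
  rw [lowerSum]
  split_ifs with h0
  · rw [hf.bot]
    exact one_ne_zero
  · exact hf.label_add_ne_zero (by omega) (by omega)

theorem IsGeneric.upperSum_ne_zero {f : PHat (Rect r s) → F} (hf : IsGeneric K f) {u v : ℤ}
    (h : (0 ≤ u ∧ u ≤ r) ∧ (0 ≤ v ∧ v ≤ s)) : upperSum f u v ≠ 0 := by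
  rw [upperSum]
  split_ifs with h0
  · rw [hf.top, inv_one]
    exact one_ne_zero
  · by_cases h1 : u < r
    · have g1 := hf.label_ne_zero (u := u + 1) (v := v) (by omega)
      by_cases h2 : v < s
      · have g2 := hf.label_ne_zero (u := u) (v := v + 1) (by omega)
        have g3 := hf.label_add_ne_zero (u := u) (v := v + 1) (u' := u + 1) (v' := v) (by omega)
          (by omega)
        rw [← one_div, ← one_div, div_add_div _ _ g1 g2, one_mul, mul_one]
        exact div_ne_zero g3 (mul_ne_zero g1 g2)
      · rw [label_of_not_mem f (u := u) (v := v + 1) (by omega), inv_zero, add_zero]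
        exact inv_ne_zero g1
    · rw [label_of_not_mem f (u := u + 1) (v := v) (by omega), inv_zero, zero_add]
      exact inv_ne_zero (hf.label_ne_zero (by omega))

theorem IsGeneric.toggle_ne_zero {f : PHat (Rect r s) → F} (hf : IsGeneric K f) (p : Rect r s) :
    toggle p f (toHat p) ≠ 0 := by
  rw [toggle_apply_self]
  exact mul_ne_zero (one_div_ne_zero (hf.ne_zero p))
    (div_ne_zero (hf.lowerSum_ne_zero (by omega)) (hf.upperSum_ne_zero (by omega)))

/-- The old label is the inverse of the new one times a nonzero element algebraic over the other
labels. If the new label were algebraic over the others, so would be the old one. -/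
theorem IsGeneric.toggle {f : PHat (Rect r s) → F} (hf : IsGeneric K f) (p : Rect r s) :
    IsGeneric K (toggle p f) := by
  have hother : ∀ q, q ≠ p → _root_.toggle p f (toHat q) = f (toHat q) := fun q hq =>
    toggle_apply_of_ne f fun h => hq (toHat_injective h)
  refine ⟨?_, ?_, ?_⟩
  · rw [toggle_apply_of_ne f (by simp [toHat]), hf.bot]
  · rw [toggle_apply_of_ne f (by simp [toHat]), hf.top]
  obtain ⟨h1, h2⟩ := AlgebraicIndependent.iff_transcendental_adjoin_image p |>.mp hf.indep
  rw [AlgebraicIndependent.iff_transcendental_adjoin_image p]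
  have himage : (fun q => _root_.toggle p f (toHat q)) '' {p}ᶜ = (fun q => f (toHat q)) '' {p}ᶜ :=
    Set.image_congr fun q hq => hother q hq
  refine ⟨?_, ?_⟩
  · have : (fun j : {j // j ≠ p} => _root_.toggle p f (toHat j)) =
        fun j : {j // j ≠ p} => f (toHat j) := funext fun j => hother j j.2
    rw [this]
    exact h1
  · rw [himage]
    set D := Algebra.adjoin K ((fun q => f (toHat q)) '' {p}ᶜ) with hD
    intro hy
    apply h2
    have hlabel : ∀ u v : ℤ, ¬(u = (p.1 : ℕ) ∧ v = (p.2 : ℕ)) → IsAlgebraic D (label f u v) := by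
      intro u v huv
      by_cases h : (0 ≤ u ∧ u ≤ r) ∧ (0 ≤ v ∧ v ≤ s)
      · obtain ⟨q, rfl, rfl, hq⟩ := exists_label_eq f h
        rw [hq]
        have hqp : q ≠ p := by
          rintro rfl
          exact huv ⟨rfl, rfl⟩
        exact isAlgebraic_algebraMap (⟨f (toHat q), Algebra.subset_adjoin ⟨q, hqp, rfl⟩⟩ : D)
      · rw [label_of_not_mem f h]
        exact isAlgebraic_zero
    have hlow : IsAlgebraic D (lowerSum f (p.1 : ℕ) (p.2 : ℕ)) := by
      rw [lowerSum]
      split_ifs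
      · rw [hf.bot]
        exact isAlgebraic_one
      · exact (hlabel _ _ (by omega)).add (hlabel _ _ (by omega))
    have hup : IsAlgebraic D (upperSum f (p.1 : ℕ) (p.2 : ℕ)) := by
      rw [upperSum]
      split_ifs
      · rw [hf.top, inv_one]
        exact isAlgebraic_one
      · exact (hlabel _ _ (by omega)).inv.add (hlabel _ _ (by omega)).inv
    have h3 : f (toHat p) = lowerSum f (p.1 : ℕ) (p.2 : ℕ) *
        (upperSum f (p.1 : ℕ) (p.2 : ℕ))⁻¹ * (_root_.toggle p f (toHat p))⁻¹ := by
      have g1 := hf.ne_zero p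
      have g2 := hf.lowerSum_ne_zero (u := (p.1 : ℕ)) (v := (p.2 : ℕ)) (by omega)
      have g3 := hf.upperSum_ne_zero (u := (p.1 : ℕ)) (v := (p.2 : ℕ)) (by omega)
      rw [toggle_apply_self]
      field_simp
    rw [h3]
    exact (hlow.mul hup.inv).mul hy.inv

theorem IsGeneric.toggle_toggle {f : PHat (Rect r s) → F} (hf : IsGeneric K f) (p : Rect r s) :
    _root_.toggle p (_root_.toggle p f) = f :=
  _root_.toggle_toggle p f (hf.toggle_ne_zero p)

theorem IsGeneric.rowmotion {f : PHat (Rect r s) → F} (hf : IsGeneric K f) (l : List (Rect r s)) :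
    IsGeneric K (rowmotion l f) := by
  induction l with
  | nil => exact hf
  | cons v l ih => exact ih.toggle v

theorem IsGeneric.rowmotionInv {f : PHat (Rect r s) → F} (hf : IsGeneric K f)
    (l : List (Rect r s)) : IsGeneric K (rowmotionInv l f) := by
  induction l generalizing f with
  | nil => exact hf
  | cons v l ih => exact ih (hf.toggle v)

theorem IsGeneric.rowmotion_rowmotionInv {f : PHat (Rect r s) → F} (hf : IsGeneric K f)
    (l : List (Rect r s)) : _root_.rowmotion l (_root_.rowmotionInv l f) = f := by
  induction l generalizing f with
  | nil => rfl
  | cons v l ih =>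
    change _root_.toggle v (_root_.rowmotion l (_root_.rowmotionInv l (_root_.toggle v f))) = f
    rw [ih (hf.toggle v), hf.toggle_toggle]

theorem IsGeneric.rowmotionPow {f : PHat (Rect r s) → F} (hf : IsGeneric K f)
    (l : List (Rect r s)) (n : ℤ) : IsGeneric K (rowmotionPow l n f) := by
  have h1 : ∀ n : ℕ, IsGeneric K ((_root_.rowmotion l)^[n] f) := by
    intro n
    induction n with
    | zero => exact hf
    | succ n ih =>
      rw [Function.iterate_succ_apply']
      exact ih.rowmotion l
  have h2 : ∀ n : ℕ, IsGeneric K ((_root_.rowmotionInv l)^[n] f) := by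
    intro n
    induction n with
    | zero => exact hf
    | succ n ih =>
      rw [Function.iterate_succ_apply']
      exact ih.rowmotionInv l
  cases n with
  | ofNat n => exact h1 n
  | negSucc n => exact h2 (n + 1)

/-- For negative exponents this needs each toggle to be a genuine involution along the orbit, which
genericity guarantees. -/
theorem IsGeneric.rowmotionPow_add_one {f : PHat (Rect r s) → F} (hf : IsGeneric K f)
    (l : List (Rect r s)) (n : ℤ) :
    _root_.rowmotionPow l (n + 1) f = _root_.rowmotion l (_root_.rowmotionPow l n f) := by
  cases n with
  | ofNat n =>
    change (_root_.rowmotion l)^[n + 1] f = _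
    rw [Function.iterate_succ_apply']
    rfl
  | negSucc n =>
    have h : IsGeneric K ((_root_.rowmotionInv l)^[n] f) := by
      obtain _ | n := n
      · exact hf
      · exact hf.rowmotionPow l (Int.negSucc n)
    have h1 : _root_.rowmotionPow l (Int.negSucc n) f =
        _root_.rowmotionInv l ((_root_.rowmotionInv l)^[n] f) := by
      change (_root_.rowmotionInv l)^[n + 1] f = _
      rw [Function.iterate_succ_apply']
    rw [h1, h.rowmotion_rowmotionInv]
    obtain _ | n := n
    · rfl
    · rfl

theorem IsGeneric.rowmotionPow_add_natCast {f : PHat (Rect r s) → F} (hf : IsGeneric K f)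
    (l : List (Rect r s)) (n : ℤ) (k : ℕ) :
    _root_.rowmotionPow l (k : ℤ) (_root_.rowmotionPow l n f) =
      _root_.rowmotionPow l (n + k) f := by
  induction k with
  | zero => simp [_root_.rowmotionPow]
  | succ k ih =>
    push_cast
    rw [(hf.rowmotionPow l n).rowmotionPow_add_one, ih, ← hf.rowmotionPow_add_one, add_assoc]

theorem isGeneric_genericLabeling (K : Type*) [Field K] (r s : ℕ) :
    IsGeneric K (genericLabeling K r s) := by
  refine ⟨rfl, rfl, ?_⟩
  have h := (MvPolynomial.algebraicIndependent_X (Rect r s) K).map'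
    (f := IsScalarTower.toAlgHom K (MvPolynomial (Rect r s) K) (RatFun K r s))
    (IsFractionRing.injective _ _)
  exact h

end Generic

/-! ### The orbit as a quotient of path determinants. -/

section Evolution

variable {F : Type*} [Field F]

theorem rectProd_swap (w : ℤ → ℤ → F) (m n R S : ℤ) :
    rectProd (fun x y => w y x) n m S R = rectProd w m n R S := by
  simp only [rectProd]
  rw [Finset.prod_product, Finset.prod_product, Finset.prod_comm]

theorem rectProd_top (w : ℤ → ℤ → F) {m n R S : ℤ} (h : n ≤ S) :
    rectProd w m n R (S + 1) * rectProd w m (n + 1) R S =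
      rectProd w m n R S * rectProd w m (n + 1) R (S + 1) := by
  have e1 := rectProd_succ_right (fun x y => w y x) (m := n) (n := m) (R := S) (S := R) (by omega)
  have e2 := rectProd_succ_right (fun x y => w y x) (m := n + 1) (n := m) (R := S) (S := R)
    (by omega)
  simp only [rectProd_swap] at e1 e2
  rw [e1, e2]
  ring

theorem rectProd_corner_left (w : ℤ → ℤ → F) {m n R S : ℤ} (hm : m ≤ R) (hn : n ≤ S) :
    w m n * (rectProd w (m + 1) n R S * rectProd w m (n + 1) R S) =
      rectProd w m n R S * rectProd w (m + 1) (n + 1) R S := by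
  rw [rectProd_succ_left w (n := n) hm, rectProd_succ_left w (n := n + 1) hm,
    ← Finset.insert_Icc_add_one_left_eq_Icc hn, Finset.prod_insert (by simp)]
  ring

theorem rectProd_corner_right (w : ℤ → ℤ → F) {m n R S : ℤ} (hm : m ≤ R + 1) (hn : n ≤ S + 1) :
    w (R + 1) (S + 1) * (rectProd w m n R (S + 1) * rectProd w m n (R + 1) S) =
      rectProd w m n R S * rectProd w m n (R + 1) (S + 1) := by
  rw [rectProd_succ_right w (S := S) hm, rectProd_succ_right w (S := S + 1) hm,
    ← Finset.insert_Icc_right_eq_Icc_add_one hn, Finset.prod_insert (by simp)]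
  ring

/-- The orbit `y 0, y 1, …` of a labeling of `[0,r] × [0,s]` under birational rowmotion, with all
labels nonzero. -/
structure IsOrbit (r s : ℕ) (y : ℕ → ℤ → ℤ → F) : Prop where
  eq_zero : ∀ (k : ℕ) (u v : ℤ), ¬((0 ≤ u ∧ u ≤ r) ∧ (0 ≤ v ∧ v ≤ s)) → y k u v = 0
  ne_zero : ∀ (k : ℕ) (u v : ℤ), (0 ≤ u ∧ u ≤ r) ∧ (0 ≤ v ∧ v ≤ s) → y k u v ≠ 0
  upper_ne_zero : ∀ (k : ℕ) (u v : ℤ), (0 ≤ u ∧ u ≤ r) ∧ (0 ≤ v ∧ v ≤ s) → ¬(u = r ∧ v = s) →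
    (y k (u + 1) v)⁻¹ + (y k u (v + 1))⁻¹ ≠ 0
  step : ∀ (k : ℕ) (u v : ℤ), (0 ≤ u ∧ u ≤ r) ∧ (0 ≤ v ∧ v ≤ s) →
    y (k + 1) u v * y k u v *
        (if u = r ∧ v = s then 1 else (y (k + 1) (u + 1) v)⁻¹ + (y (k + 1) u (v + 1))⁻¹) =
      if u = 0 ∧ v = 0 then 1 else y k (u - 1) v + y k u (v - 1)

theorem IsOrbit.swap {r s : ℕ} {y : ℕ → ℤ → ℤ → F} (h : IsOrbit r s y) :
    IsOrbit s r (fun k u v => y k v u) := by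
  refine ⟨fun k u v huv => h.eq_zero k v u (by omega), fun k u v huv => h.ne_zero k v u (by omega),
    fun k u v huv hne => ?_, fun k u v huv => ?_⟩
  · rw [add_comm]
    exact h.upper_ne_zero k v u (by omega) (by omega)
  · have := h.step k v u (by omega)
    rw [add_comm (y (k + 1) v (u + 1))⁻¹, add_comm (y k v (u - 1))]
    simpa only [and_comm] using this

/-- The formula for `y (k+1) i j` as a quotient of path determinants. -/
def PathFormula (r s : ℕ) (y : ℕ → ℤ → ℤ → F) (w : ℤ → ℤ → F) (k : ℕ) (i j : ℤ) : Prop :=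
  -- Since `t` is a natural number, the condition is empty when [k-i]_+ + [k-j]_+ > k.
  ∀ (t : ℕ) (m n R S : ℤ), (t : ℤ) = k - max (k - i) 0 - max (k - j) 0 → m = max (i - k) 0 →
    n = max (j - k) 0 → R = r - max (k - j) 0 → S = s - max (k - i) 0 →
    pathDet w (t + 1) m n R S ≠ 0 ∧
      y (k + 1) i j * pathDet w (t + 1) m n R S = pathDet w t m n R S

theorem PathFormula.swap {r s : ℕ} {y : ℕ → ℤ → ℤ → F} {w : ℤ → ℤ → F} {k : ℕ} {i j : ℤ}
    (h : PathFormula r s y w k i j) :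
    PathFormula s r (fun k u v => y k v u) (fun u v => w v u) k j i := by
  intro t m n R S ht hm hn hR hS
  rw [pathDet_swap w (t + 1) n m S R, pathDet_swap w t n m S R]
  exact h t n m S R (by omega) hn hm hS hR

/-- The common end of the three cases: `L` and `U` are the lower and upper sums, `D` their shared
denominator and `ω` the weight in the three-term relation. Nonvanishing of `U` yields that of the
new denominator `X₁`. -/
theorem solve_step {y' y U L X₀ X₁ Z₀ Z₁ ω D : F} (hω : ω ≠ 0) (hD : D ≠ 0) (hy : y ≠ 0)
    (hU0 : U ≠ 0) (hZ₁ : Z₁ ≠ 0) (hZ : y * Z₁ = Z₀) (hstep : y' * y * U = L)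
    (hL : ω * (L * D) = X₀ * Z₀) (hU : ω * (U * D) = X₁ * Z₁) : X₁ ≠ 0 ∧ y' * X₁ = X₀ := by
  refine ⟨fun h => ?_, ?_⟩
  · rw [h, zero_mul] at hU
    exact mul_ne_zero hω (mul_ne_zero hU0 hD) hU
  · refine mul_right_cancel₀ (mul_ne_zero hy hZ₁) ?_
    linear_combination y' * y * (-hU) + ω * D * hstep + hL - X₀ * hZ

variable {r s : ℕ} {y : ℕ → ℤ → ℤ → F} {w : ℤ → ℤ → F}

/-- The reciprocal of a label that is known as a quotient `P / X`, or is off the rectangle. -/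
theorem inv_eq_div_of {a X P : F} (hP : P ≠ 0) (h : (X ≠ 0 ∧ a * X = P) ∨ (a = 0 ∧ X = 0)) :
    a⁻¹ = X / P := by
  rcases h with ⟨hX, h⟩ | ⟨rfl, rfl⟩
  · rw [← h]
    have : a ≠ 0 := by
      rintro rfl
      exact hP (by rw [← h, zero_mul])
    field_simp
  · simp

/-- The inverse labels after one rowmotion satisfy the first-step recursion of the path sums ending
at (r,s). -/
theorem PathFormula.zero (h : IsOrbit r s y)
    (hw : ∀ u v : ℤ, (0 ≤ u ∧ u ≤ r) ∧ (0 ≤ v ∧ v ≤ s) →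
      w u v * (if u = 0 ∧ v = 0 then 1 else y 0 (u - 1) v + y 0 u (v - 1)) = y 0 u v)
    (N : ℕ) (i j : ℤ) (hij : (0 ≤ i ∧ i ≤ r) ∧ (0 ≤ j ∧ j ≤ s)) (hN : (N : ℤ) = r - i + (s - j)) :
    PathFormula r s y w 0 i j := by
  have key : y 1 i j * greens w i j r s = 1 := by
    induction N using Nat.strong_induction_on generalizing i j with
    | _ N ih =>
      have e : ∀ i' j', i' + j' = i + j + 1 → 0 ≤ i' → 0 ≤ j' →
          (y 1 i' j')⁻¹ = greens w i' j' r s := by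
        intro i' j' h1 h2 h3
        by_cases h4 : i' ≤ r ∧ j' ≤ s
        · exact inv_eq_of_mul_eq_one_right (ih (N - 1) (by omega) i' j' (by omega) (by omega))
        · rw [h.eq_zero _ _ _ (by omega), greens_of_not_le w h4, inv_zero]
      have h1 := h.step 0 i j hij
      rw [zero_add, e _ _ (by ring) (by omega) (by omega), e _ _ (by ring) (by omega) (by omega)]
        at h1
      have h2 := h.ne_zero 0 i j hij
      rw [greens_eq]
      have h3 := hw i j hij
      rw [← h1] at h3
      refine mul_right_cancel₀ h2 ?_
      rw [one_mul]
      nth_rewrite 2 [← h3]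
      by_cases h4 : i = r ∧ j = s
      · rw [if_pos h4, if_pos h4, greens_of_not_le w (by omega), greens_of_not_le w (by omega)]
        ring
      · rw [if_neg h4, if_neg h4]
        ring
  intro t m n R S ht hm hn hR hS
  obtain rfl : t = 0 := by omega
  obtain rfl : m = i := by omega
  obtain rfl : n = j := by omega
  obtain rfl : R = r := by omega
  obtain rfl : S = s := by omega
  rw [pathDet_one, pathDet_zero]
  exact ⟨right_ne_zero_of_mul_eq_one key, key⟩

/-- Here the sinks stay at the corner (r,s), and the octahedron relation with fixed sinks evaluates
the lower sum with parameter `k` and the upper sum with `k + 1`. -/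
theorem PathFormula.succ_of_le_of_le (h : IsOrbit r s y)
    (hw0 : ∀ u v : ℤ, (0 ≤ u ∧ u ≤ r) ∧ (0 ≤ v ∧ v ≤ s) → w u v ≠ 0)
    {k : ℕ} {i j : ℤ} (hij : (0 ≤ i ∧ i ≤ r) ∧ (0 ≤ j ∧ j ≤ s)) (hki : k + 1 ≤ i) (hkj : k + 1 ≤ j)
    (h1 : PathFormula r s y w k i j) (h2 : 1 ≤ i → PathFormula r s y w k (i - 1) j)
    (h3 : 1 ≤ j → PathFormula r s y w k i (j - 1))
    (h4 : i < r → PathFormula r s y w (k + 1) (i + 1) j)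
    (h5 : j < s → PathFormula r s y w (k + 1) i (j + 1)) : PathFormula r s y w (k + 1) i j := by
  intro t m n R S ht hm hn hR hS
  obtain rfl : t = k + 1 := by omega
  obtain rfl : R = r := by omega
  obtain rfl : S = s := by omega
  obtain ⟨hZ1, hZ⟩ := h1 k (m + 1) (n + 1) r s (by omega) (by omega) (by omega) (by omega) (by omega)
  obtain ⟨hQ, hq⟩ := h2 (by omega) k m (n + 1) r s (by omega) (by omega) (by omega) (by omega)
    (by omega)
  obtain ⟨hP, hp⟩ := h3 (by omega) k (m + 1) n r s (by omega) (by omega) (by omega) (by omega)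
    (by omega)
  have hstep := h.step (k + 1) i j hij
  have hω : w m n ≠ 0 := hw0 m n (by omega)
  have hU0 : (if i = r ∧ j = s then 1 else
      (y (k + 1 + 1) (i + 1) j)⁻¹ + (y (k + 1 + 1) i (j + 1))⁻¹) ≠ 0 := by
    split_ifs with hc
    · exact one_ne_zero
    · exact h.upper_ne_zero _ _ _ hij hc
  refine solve_step hω (mul_ne_zero hP hQ) (h.ne_zero (k + 1) i j hij) hU0 hZ1 hZ hstep ?_ ?_
  · rw [if_neg (by omega), ← pathDet_octahedron w (by omega), ← hp, ← hq]
    ring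
  · split_ifs with hc
    -- At (r,s) the octahedron relation with `k + 1` is out of range; all four determinants are full
    -- products over rectangles.
    · rw [one_mul, pathDet_full_swap w (t := k + 1) (m := m + 1) (n := n) (by push_cast; omega) (by push_cast; omega)
        (by omega), pathDet_full w (t := k + 1) (m := m) (n := n + 1) (by push_cast; omega) (by push_cast; omega)
        (by omega), pathDet_full w (t := k + 1 + 1) (m := m) (n := n) (by push_cast; omega)
        (by push_cast; omega) (by omega), pathDet_full w (t := k + 1) (m := m + 1) (n := n + 1) (by push_cast; omega)
        (by push_cast; omega) (by omega)]
      exact rectProd_corner_left w (by omega) (by omega)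
    · have e1 : (y (k + 1 + 1) (i + 1) j)⁻¹ =
          pathDet w (k + 1 + 1) (m + 1) n r s / pathDet w (k + 1) (m + 1) n r s := by
        refine inv_eq_div_of hP ?_
        by_cases hi : i < r
        · exact Or.inl (h4 hi (k + 1) (m + 1) n r s (by omega) (by omega) (by omega) (by omega)
            (by omega))
        -- Off the rectangle the label and the path determinant both vanish, and with `0⁻¹ = 0` the
        -- quotient formula persists.
        · exact Or.inr ⟨h.eq_zero _ _ _ (by omega),
            pathDet_eq_zero w (by omega) (Or.inl (by push_cast; omega))⟩
      have e2 : (y (k + 1 + 1) i (j + 1))⁻¹ =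
          pathDet w (k + 1 + 1) m (n + 1) r s / pathDet w (k + 1) m (n + 1) r s := by
        refine inv_eq_div_of hQ ?_
        by_cases hj : j < s
        · exact Or.inl (h5 hj (k + 1) m (n + 1) r s (by omega) (by omega) (by omega) (by omega)
            (by omega))
        · exact Or.inr ⟨h.eq_zero _ _ _ (by omega),
            pathDet_eq_zero w (by omega) (Or.inr (by push_cast; omega))⟩
      rw [e1, e2, ← pathDet_octahedron w (by push_cast; omega)]
      field_simp

/-- Passing from `k` to `k + 1` now lowers both `n` and `S` by one, the setting of condensation; no
weight appears. -/
theorem PathFormula.succ_of_gt_of_le (h : IsOrbit r s y)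
    {k : ℕ} {i j : ℤ} (hij : (0 ≤ i ∧ i ≤ r) ∧ (0 ≤ j ∧ j ≤ s)) (hki : i < k + 1) (hkj : k + 1 ≤ j)
    (h1 : PathFormula r s y w k i j) (h2 : 1 ≤ i → PathFormula r s y w k (i - 1) j)
    (h3 : 1 ≤ j → PathFormula r s y w k i (j - 1))
    (h4 : i < r → PathFormula r s y w (k + 1) (i + 1) j)
    (h5 : j < s → PathFormula r s y w (k + 1) i (j + 1)) : PathFormula r s y w (k + 1) i j := by
  intro t m n R S ht hm hn hR hS
  have hti : (t : ℤ) = i := by omega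
  obtain rfl : R = r := by omega
  obtain rfl : m = 0 := by omega
  obtain ⟨hZ1, hZ⟩ := h1 t 0 (n + 1) r (S + 1) (by omega) (by omega) (by omega) (by omega) (by omega)
  obtain ⟨hP, hp⟩ := h3 (by omega) t 0 n r (S + 1) (by omega) (by omega) (by omega) (by omega)
    (by omega)
  obtain ⟨hQ, hlow⟩ : pathDet w t 0 (n + 1) r S ≠ 0 ∧
      (y (k + 1) (i - 1) j + y (k + 1) i (j - 1)) *
        (pathDet w (t + 1) 0 n r (S + 1) * pathDet w t 0 (n + 1) r S) =
      pathDet w t 0 n r S * pathDet w t 0 (n + 1) r (S + 1) := by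
    obtain _ | d := t
    -- Here `i = 0`: the left neighbour is missing and only the neighbour below contributes.
    · simp only [pathDet_zero] at hp ⊢
      rw [h.eq_zero (k + 1) (i - 1) j (by omega), zero_add, mul_one, mul_one, hp]
      exact ⟨one_ne_zero, rfl⟩
    · obtain ⟨hQ, hq⟩ := h2 (by omega) d 0 (n + 1) r S (by omega) (by omega) (by omega) (by omega)
        (by omega)
      refine ⟨hQ, ?_⟩
      rw [← pathDet_condensation w (by omega), ← hp, ← hq]
      ring
  have hstep := h.step (k + 1) i j hij
  have hU0 : (if i = r ∧ j = s then 1 else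
      (y (k + 1 + 1) (i + 1) j)⁻¹ + (y (k + 1 + 1) i (j + 1))⁻¹) ≠ 0 := by
    split_ifs with hc
    · exact one_ne_zero
    · exact h.upper_ne_zero _ _ _ hij hc
  refine solve_step (one_ne_zero (α := F)) (mul_ne_zero hP hQ) (h.ne_zero (k + 1) i j hij) hU0 hZ1
    hZ hstep ?_ ?_
  · rw [if_neg (by omega), one_mul, hlow]
  · split_ifs with hc
    · rw [one_mul, one_mul,
        pathDet_full_swap w (t := t + 1) (n := n) (S := S + 1) (by push_cast; omega)
          (by push_cast; omega) (by omega),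
        pathDet_full w (t := t) (n := n + 1) (S := S) (by omega) (by omega) (by omega),
        pathDet_full w (t := t + 1) (n := n) (S := S) (by push_cast; omega)
          (by push_cast; omega) (by omega),
        pathDet_full w (t := t + 1) (n := n + 1) (S := S + 1) (by push_cast; omega)
          (by push_cast; omega) (by omega)]
      exact rectProd_top w (by omega)
    · have e1 : (y (k + 1 + 1) (i + 1) j)⁻¹ =
          pathDet w (t + 2) 0 n r (S + 1) / pathDet w (t + 1) 0 n r (S + 1) := by
        refine inv_eq_div_of hP ?_
        by_cases hi : i < r
        · exact Or.inl (h4 hi (t + 1) 0 n r (S + 1) (by omega) (by omega) (by omega) (by omega)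
            (by omega))
        · exact Or.inr ⟨h.eq_zero _ _ _ (by omega),
            pathDet_eq_zero w (by omega) (Or.inl (by push_cast; omega))⟩
      have e2 : (y (k + 1 + 1) i (j + 1))⁻¹ =
          pathDet w (t + 1) 0 (n + 1) r S / pathDet w t 0 (n + 1) r S := by
        refine inv_eq_div_of hQ ?_
        by_cases hj : j < s
        · exact Or.inl (h5 hj t 0 (n + 1) r S (by omega) (by omega) (by omega) (by omega)
            (by omega))
        · exact Or.inr ⟨h.eq_zero _ _ _ (by omega),
            pathDet_eq_zero w (by omega) (Or.inr (by push_cast; omega))⟩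
      rw [e1, e2, ← pathDet_condensation w (by omega)]
      field_simp

/-- The sources stay at the origin while the upper corner of the rectangle shrinks, so the
octahedron relation with fixed sources applies. -/
theorem PathFormula.succ_of_gt_of_gt (h : IsOrbit r s y)
    (hw0 : ∀ u v : ℤ, (0 ≤ u ∧ u ≤ r) ∧ (0 ≤ v ∧ v ≤ s) → w u v ≠ 0)
    {k : ℕ} {i j : ℤ} (hij : (0 ≤ i ∧ i ≤ r) ∧ (0 ≤ j ∧ j ≤ s)) (hki : i < k + 1) (hkj : j < k + 1)
    (h1 : PathFormula r s y w k i j) (h2 : 1 ≤ i → PathFormula r s y w k (i - 1) j)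
    (h3 : 1 ≤ j → PathFormula r s y w k i (j - 1))
    (h4 : i < r → PathFormula r s y w (k + 1) (i + 1) j)
    (h5 : j < s → PathFormula r s y w (k + 1) i (j + 1)) : PathFormula r s y w (k + 1) i j := by
  intro t m n R S ht hm hn hR hS
  obtain rfl : m = 0 := by omega
  obtain rfl : n = 0 := by omega
  obtain ⟨hZ1, hZ⟩ := h1 (t + 1) 0 0 (R + 1) (S + 1) (by omega) (by omega) (by omega) (by omega)
    (by omega)
  obtain ⟨hQ, hq⟩ := h2 (by omega) t 0 0 (R + 1) S (by omega) (by omega) (by omega) (by omega)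
    (by omega)
  obtain ⟨hP, hp⟩ := h3 (by omega) t 0 0 R (S + 1) (by omega) (by omega) (by omega) (by omega)
    (by omega)
  have hstep := h.step (k + 1) i j hij
  have hω : w (R + 1) (S + 1) ≠ 0 := hw0 _ _ (by omega)
  have hU0 : (if i = r ∧ j = s then 1 else
      (y (k + 1 + 1) (i + 1) j)⁻¹ + (y (k + 1 + 1) i (j + 1))⁻¹) ≠ 0 := by
    split_ifs with hc
    · exact one_ne_zero
    · exact h.upper_ne_zero _ _ _ hij hc
  have hoct : ∀ t' : ℕ, 2 * (t' : ℤ) + 1 ≤ R + S + 2 →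
      w (R + 1) (S + 1) * (pathDet w (t' + 1) 0 0 R (S + 1) * pathDet w t' 0 0 (R + 1) S +
        pathDet w (t' + 1) 0 0 (R + 1) S * pathDet w t' 0 0 R (S + 1)) =
      pathDet w (t' + 1) 0 0 (R + 1) (S + 1) * pathDet w t' 0 0 R S := by
    intro t' ht'
    have := pathDet_octahedron_neg w (k := t') (m := 0) (n := 0) (R := R + 1) (S := S + 1)
      (by omega)
    simpa only [add_sub_cancel_right] using this
  refine solve_step hω (mul_ne_zero hP hQ) (h.ne_zero (k + 1) i j hij) hU0 hZ1 hZ hstep ?_ ?_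
  · rw [if_neg (by omega), mul_comm (pathDet w t 0 0 R S), ← hoct t (by omega), ← hp, ← hq]
    ring
  · split_ifs with hc
    · rw [one_mul,
        pathDet_full_swap w (t := t + 1) (R := R) (S := S + 1) (by push_cast; omega)
          (by push_cast; omega) (by omega),
        pathDet_full w (t := t + 1) (R := R + 1) (S := S) (by push_cast; omega)
          (by push_cast; omega) (by omega),
        pathDet_full w (t := t + 1) (R := R) (S := S) (by push_cast; omega)
          (by push_cast; omega) (by omega),
        pathDet_full w (t := t + 1 + 1) (R := R + 1) (S := S + 1) (by push_cast; omega)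
          (by push_cast; omega) (by omega)]
      exact rectProd_corner_right w (by omega) (by omega)
    · have e1 : (y (k + 1 + 1) (i + 1) j)⁻¹ =
          pathDet w (t + 2) 0 0 R (S + 1) / pathDet w (t + 1) 0 0 R (S + 1) := by
        refine inv_eq_div_of hP ?_
        by_cases hi : i < r
        · exact Or.inl (h4 hi (t + 1) 0 0 R (S + 1) (by omega) (by omega) (by omega) (by omega)
            (by omega))
        · exact Or.inr ⟨h.eq_zero _ _ _ (by omega),
            pathDet_eq_zero w (by omega) (Or.inl (by push_cast; omega))⟩
      have e2 : (y (k + 1 + 1) i (j + 1))⁻¹ =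
          pathDet w (t + 2) 0 0 (R + 1) S / pathDet w (t + 1) 0 0 (R + 1) S := by
        refine inv_eq_div_of hQ ?_
        by_cases hj : j < s
        · exact Or.inl (h5 hj (t + 1) 0 0 (R + 1) S (by omega) (by omega) (by omega) (by omega)
            (by omega))
        · exact Or.inr ⟨h.eq_zero _ _ _ (by omega),
            pathDet_eq_zero w (by omega) (Or.inr (by push_cast; omega))⟩
      rw [e1, e2, mul_comm (pathDet w (t + 1) 0 0 R S), ← hoct (t + 1) (by push_cast; omega)]
      field_simp

theorem IsOrbit.pathFormula (h : IsOrbit r s y)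
    (hw : ∀ u v : ℤ, (0 ≤ u ∧ u ≤ r) ∧ (0 ≤ v ∧ v ≤ s) →
      w u v * (if u = 0 ∧ v = 0 then 1 else y 0 (u - 1) v + y 0 u (v - 1)) = y 0 u v)
    (k : ℕ) (i j : ℤ) (hij : (0 ≤ i ∧ i ≤ r) ∧ (0 ≤ j ∧ j ≤ s)) : PathFormula r s y w k i j := by
  have hw0 : ∀ u v : ℤ, (0 ≤ u ∧ u ≤ r) ∧ (0 ≤ v ∧ v ≤ s) → w u v ≠ 0 := by
    intro u v huv
    refine left_ne_zero_of_mul (b := if u = 0 ∧ v = 0 then 1 else y 0 (u - 1) v + y 0 u (v - 1)) ?_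
    rw [hw u v huv]
    exact h.ne_zero 0 u v huv
  induction k generalizing i j with
  | zero => exact PathFormula.zero h hw (r - i + (s - j) : ℤ).toNat i j hij (by omega)
  | succ k ih =>
    obtain ⟨N, hN⟩ : ∃ N : ℕ, (N : ℤ) = r - i + (s - j) := ⟨(r - i + (s - j) : ℤ).toNat, by omega⟩
    induction N using Nat.strong_induction_on generalizing i j with
    | _ N ihN =>
      have h1 := ih i j hij
      have h2 : 1 ≤ i → PathFormula r s y w k (i - 1) j := fun _ => ih _ _ (by omega)
      have h3 : 1 ≤ j → PathFormula r s y w k i (j - 1) := fun _ => ih _ _ (by omega)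
      have h4 : i < r → PathFormula r s y w (k + 1) (i + 1) j := fun _ =>
        ihN (N - 1) (by omega) _ _ (by omega) (by omega)
      have h5 : j < s → PathFormula r s y w (k + 1) i (j + 1) := fun _ =>
        ihN (N - 1) (by omega) _ _ (by omega) (by omega)
      rcases le_or_gt ((k : ℤ) + 1) i with hi | hi <;> rcases le_or_gt ((k : ℤ) + 1) j with hj | hj
      · exact PathFormula.succ_of_le_of_le h hw0 hij hi hj h1 h2 h3 h4 h5
      -- The other mixed case is the mirror image under exchange of the coordinates.
      · exact (PathFormula.succ_of_gt_of_le h.swap (by omega) hj hi h1.swap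
          (fun hh => (h3 hh).swap) (fun hh => (h2 hh).swap) (fun hh => (h5 hh).swap)
          (fun hh => (h4 hh).swap)).swap
      · exact PathFormula.succ_of_gt_of_le h hij hi hj h1 h2 h3 h4 h5
      · exact PathFormula.succ_of_gt_of_gt h hw0 hij hi hj h1 h2 h3 h4 h5

end Evolution

/-! ### Reciprocity and translation back to the polynomials φ. -/

section Main

variable {F : Type*} [Field F] {r s : ℕ} {K : Type*} [Field K] [Algebra K F]

theorem IsGeneric.isOrbit {f : PHat (Rect r s) → F} (hf : IsGeneric K f) {l : List (Rect r s)}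
    (hl : IsLinearExtension l) :
    IsOrbit r s fun k => label (_root_.rowmotionPow l (k : ℤ) f) := by
  have hg : ∀ k : ℕ, IsGeneric K (_root_.rowmotionPow l (k : ℤ) f) := fun k => hf.rowmotionPow l k
  refine ⟨fun k u v h => label_of_not_mem _ h, fun k u v h => (hg k).label_ne_zero h,
    fun k u v h hne => ?_, fun k u v h => ?_⟩
  · have := (hg k).upperSum_ne_zero h
    rwa [upperSum, if_neg hne] at this
  · obtain ⟨p, rfl, rfl, hp⟩ := exists_label_eq (_root_.rowmotionPow l (k : ℤ) f) h
    have h0 := (hg k).ne_zero p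
    have hsucc : _root_.rowmotionPow l ((k + 1 : ℕ) : ℤ) f =
        _root_.rowmotion l (_root_.rowmotionPow l (k : ℤ) f) := by
      rw [Nat.cast_succ, hf.rowmotionPow_add_one]
    have hup := (hg (k + 1)).upperSum_ne_zero h
    have hstep := rowmotion_apply hl (_root_.rowmotionPow l (k : ℤ) f) p
    rw [← hsucc] at hstep
    have hu : upperSum (_root_.rowmotionPow l ((k + 1 : ℕ) : ℤ) f) (p.1 : ℕ) (p.2 : ℕ) =
        if ((p.1 : ℕ) : ℤ) = r ∧ ((p.2 : ℕ) : ℤ) = s then 1 else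
          (label (_root_.rowmotionPow l ((k + 1 : ℕ) : ℤ) f) ((p.1 : ℕ) + 1) (p.2 : ℕ))⁻¹ +
          (label (_root_.rowmotionPow l ((k + 1 : ℕ) : ℤ) f) (p.1 : ℕ) ((p.2 : ℕ) + 1))⁻¹ := by
      rw [upperSum, (hg (k + 1)).top, inv_one]
    have hlow : lowerSum (_root_.rowmotionPow l (k : ℤ) f) (p.1 : ℕ) (p.2 : ℕ) =
        if ((p.1 : ℕ) : ℤ) = 0 ∧ ((p.2 : ℕ) : ℤ) = 0 then 1 else
          label (_root_.rowmotionPow l (k : ℤ) f) ((p.1 : ℕ) - 1) (p.2 : ℕ) +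
          label (_root_.rowmotionPow l (k : ℤ) f) (p.1 : ℕ) ((p.2 : ℕ) - 1) := by
      rw [lowerSum, (hg k).bot]
    rw [← hu, ← hlow, label_coe, label_coe, hstep]
    field_simp

/-- The weights of the lattice paths: each label divided by the sum of the labels it covers. -/
def labelWeight (f : PHat (Rect r s) → F) (u v : ℤ) : F := label f u v / lowerSum f u v

theorem IsGeneric.labelWeight_mul {f : PHat (Rect r s) → F} (hf : IsGeneric K f) {u v : ℤ}
    (h : (0 ≤ u ∧ u ≤ r) ∧ (0 ≤ v ∧ v ≤ s)) :
    labelWeight f u v * (if u = 0 ∧ v = 0 then 1 else label f (u - 1) v + label f u (v - 1)) =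
      label f u v := by
  have h0 := hf.lowerSum_ne_zero h
  have h1 := div_mul_cancel₀ (label f u v) h0
  rw [labelWeight]
  rwa [lowerSum, hf.bot] at h1 ⊢

theorem IsGeneric.pathFormula {f : PHat (Rect r s) → F} (hf : IsGeneric K f)
    {l : List (Rect r s)} (hl : IsLinearExtension l) (k : ℕ) (p : Rect r s) :
    PathFormula r s (fun k => label (_root_.rowmotionPow l (k : ℤ) f)) (labelWeight f) k
      (p.1 : ℕ) (p.2 : ℕ) :=
  (hf.isOrbit hl).pathFormula (fun _ _ h => hf.labelWeight_mul h) k _ _ (by omega)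

/-- A label is its weight times the sum of the labels below it, which is exactly the last-step
recursion of the path sums from the origin. -/
theorem IsGeneric.greens_labelWeight {f : PHat (Rect r s) → F} (hf : IsGeneric K f) (N : ℕ)
    {u v : ℤ} (hN : u + v = N) (hu : u ≤ r) (hv : v ≤ s) :
    greens (labelWeight f) 0 0 u v = label f u v := by
  induction N using Nat.strong_induction_on generalizing u v with
  | _ N ih =>
    by_cases h : 0 ≤ u ∧ 0 ≤ v
    · have key := hf.labelWeight_mul (u := u) (v := v) (by omega)
      by_cases h0 : u = 0 ∧ v = 0
      · obtain ⟨rfl, rfl⟩ := h0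
        rw [greens_self]
        simpa using key
      · rw [if_neg h0] at key
        rw [greens_step_last _ (by omega), ih (N - 1) (by omega) (by omega) (by omega) hv,
          ih (N - 1) (by omega) (by omega) hu (by omega), key]
    · rw [greens_of_not_le _ (by omega), label_of_not_mem _ (by omega)]

/-- Reciprocity: `i + j + 1` applications of rowmotion invert and rotate the label at `(i, j)`. -/
theorem IsGeneric.rowmotionPow_reciprocity {f : PHat (Rect r s) → F} (hf : IsGeneric K f)
    {l : List (Rect r s)} (hl : IsLinearExtension l) (i : Fin (r + 1)) (j : Fin (s + 1)) :
    _root_.rowmotionPow l (((i : ℕ) + (j : ℕ) + 1 : ℕ) : ℤ) f (toHat (i, j)) =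
      1 / f (toHat (Fin.rev i, Fin.rev j)) := by
  -- At `k = i + j` the number `t` is 0, and the denominator is a single path sum from the origin to
  -- (r-i, s-j).
  obtain ⟨h1, h2⟩ := hf.pathFormula hl ((i : ℕ) + (j : ℕ)) (i, j) 0 0 0 (r - (i : ℕ)) (s - (j : ℕ))
    (by push_cast; omega) (by push_cast; omega) (by push_cast; omega) (by push_cast; omega)
    (by push_cast; omega)
  have hrev : label f (r - (i : ℕ)) (s - (j : ℕ)) = f (toHat (Fin.rev i, Fin.rev j)) := by
    rw [← label_coe f]
    congr 1
    · rw [Fin.val_rev]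
      omega
    · rw [Fin.val_rev]
      omega
  rw [pathDet_zero, pathDet_one, hf.greens_labelWeight (r - (i : ℕ) + (s - (j : ℕ)))
    (by omega) (by omega) (by omega), hrev] at h2
  rw [← label_coe (_root_.rowmotionPow l _ f)]
  exact eq_one_div_of_mul_eq_one_left h2

theorem labelWeight_genericLabeling (K : Type*) [Field K] (r s : ℕ) (u v : ℤ) :
    labelWeight (genericLabeling K r s) u v = (aVal K r s (u, v))⁻¹ := by
  by_cases h : (0 ≤ u ∧ u ≤ r) ∧ (0 ≤ v ∧ v ≤ s)
  · obtain ⟨i, rfl⟩ : ∃ i : Fin (r + 1), ((i : ℕ) : ℤ) = u :=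
      ⟨⟨u.toNat, by omega⟩, by simp only; omega⟩
    obtain ⟨j, rfl⟩ : ∃ j : Fin (s + 1), ((j : ℕ) : ℤ) = v :=
      ⟨⟨v.toNat, by omega⟩, by simp only; omega⟩
    rw [labelWeight, label_coe, aVal, dif_pos h]
    simp only [Int.toNat_natCast, Fin.eta]
    rw [aElem, sum_covered, inv_div]
  · rw [labelWeight, label_of_not_mem _ h, aVal, dif_neg h, zero_div, inv_zero]

theorem aVal_ne_zero (K : Type*) [Field K] {r s : ℕ} {u v : ℤ}
    (h : (0 ≤ u ∧ u ≤ r) ∧ (0 ≤ v ∧ v ≤ s)) : aVal K r s (u, v) ≠ 0 := by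
  have hg := isGeneric_genericLabeling K r s
  have h1 : labelWeight (genericLabeling K r s) u v ≠ 0 :=
    div_ne_zero (hg.label_ne_zero h) (hg.lowerSum_ne_zero h)
  rw [labelWeight_genericLabeling] at h1
  exact fun h2 => h1 (by rw [h2, inv_zero])

/-- The shifted polynomial of path families is the product of the `A`'s over a rectangle, times
a determinant of path sums for the generic labeling. -/
theorem evalA_mu_phi (K : Type*) [Field K] {r s t : ℕ} {a b m n : ℤ} (ha : 0 ≤ a) (hb : 0 ≤ b)
    (hm : a ≤ m) (hn : b ≤ n) (hr : (t : ℤ) ≤ r - m + 1) (hs : (t : ℤ) ≤ s - n + 1) :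
    (∏ p ∈ Finset.Icc m (r : ℤ) ×ˢ Finset.Icc n (s : ℤ), aVal K r s (p.1 - a, p.2 - b)) ≠ 0 ∧
    evalA K r s (mu a b (phi r s t m n)) =
      (∏ p ∈ Finset.Icc m (r : ℤ) ×ˢ Finset.Icc n (s : ℤ), aVal K r s (p.1 - a, p.2 - b)) *
        pathDet (labelWeight (genericLabeling K r s)) t (m - a) (n - b) (r - a) (s - b) := by
  set ev : MvPolynomial (ℤ × ℤ) ℤ →+* RatFun K r s :=
    ((evalA K r s).comp (mu a b)).toRingHom with hev
  have hX : ∀ p, ev (MvPolynomial.X p) = aVal K r s (p.1 - a, p.2 - b) := by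
    intro p
    simp [hev, evalA, mu]
  have hA : ∀ p ∈ Finset.Icc m (r : ℤ) ×ˢ Finset.Icc n (s : ℤ),
      aVal K r s (p.1 - a, p.2 - b) ≠ 0 := by
    intro p hp
    rw [Finset.mem_product, Finset.mem_Icc, Finset.mem_Icc] at hp
    exact aVal_ne_zero K (by omega)
  refine ⟨Finset.prod_ne_zero_iff.mpr hA, ?_⟩
  have h1 := ringHom_phi ev (fun p hp => by rw [hX]; exact hA p hp) hr hs
  simp only [hX] at h1
  rw [← pathDet_shift]
  simp only [labelWeight_genericLabeling]
  exact h1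

end Main

theorem theorem2p5 (K : Type*) [Field K] (r s : ℕ)
    (l : List (Rect r s)) (hl : IsLinearExtension l)
    (k : ℕ) (hk : k ≤ r + s + 1) (i : Fin (r + 1)) (j : Fin (s + 1))
    (a b M : ℕ) (ha : a = ((k : ℤ) - (j : ℕ)).toNat) (hb : b = ((k : ℤ) - (i : ℕ)).toNat)
    (hM : M = b + a) :
    -- all labels are nonzero, hence no denominator of a toggle vanishes along the iteration
    rho K l ((k : ℤ) + 1) (i, j) ≠ 0 ∧
    (M ≤ k →
      evalA K r s (mu a b (phi r s (k - M + 1) ((i : ℕ) - (k : ℤ) + M) ((j : ℕ) - (k : ℤ) + M))) ≠ 0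
      ∧ rho K l ((k : ℤ) + 1) (i, j) =
        evalA K r s (mu a b (phi r s (k - M) ((i : ℕ) - (k : ℤ) + M) ((j : ℕ) - (k : ℤ) + M))) /
        evalA K r s
          (mu a b (phi r s (k - M + 1) ((i : ℕ) - (k : ℤ) + M) ((j : ℕ) - (k : ℤ) + M)))) ∧
    (k ≤ M →
      rho K l ((k : ℤ) + 1) (i, j) =
        1 / rho K l ((k : ℤ) - (i : ℕ) - (j : ℕ)) (Fin.rev i, Fin.rev j)) := by
  have hf := isGeneric_genericLabeling K r s
  refine ⟨(hf.rowmotionPow l _).ne_zero _, fun hMk => ?_, fun _ => ?_⟩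
  · obtain ⟨h0, e0⟩ := evalA_mu_phi K (r := r) (s := s) (t := k - M) (a := a) (b := b)
      (m := (i : ℕ) - (k : ℤ) + M) (n := (j : ℕ) - (k : ℤ) + M)
      (by omega) (by omega) (by omega) (by omega) (by omega) (by omega)
    obtain ⟨-, e1⟩ := evalA_mu_phi K (r := r) (s := s) (t := k - M + 1) (a := a) (b := b)
      (m := (i : ℕ) - (k : ℤ) + M) (n := (j : ℕ) - (k : ℤ) + M)
      (by omega) (by omega) (by omega) (by omega) (by omega) (by omega)
    obtain ⟨h2, h3⟩ := hf.pathFormula hl k (i, j) (k - M) ((i : ℕ) - (k : ℤ) + M - a)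
      ((j : ℕ) - (k : ℤ) + M - b) (r - a) (s - b) (by dsimp only; omega) (by dsimp only; omega)
      (by dsimp only; omega) (by dsimp only; omega) (by dsimp only; omega)
    -- Both polynomials live on the same rectangle, so its product of A's cancels. After the shift
    -- by (a,b) its lower corner is ([i-k]_+, [j-k]_+) and its upper corner (r-a, s-b), as in
    -- `PathFormula`.
    rw [e0, e1, mul_div_mul_left _ _ h0]
    refine ⟨mul_ne_zero h0 h2, eq_div_of_mul_eq h2 ?_⟩
    dsimp only at h3
    rwa [label_coe, Nat.cast_succ] at h3
  -- Reciprocity starts from the labeling after k - i - j rowmotions, again generic; the exponents k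
  -- - i - j and i + j + 1 add up to k + 1.
  · have h := (hf.rowmotionPow l ((k : ℤ) - (i : ℕ) - (j : ℕ))).rowmotionPow_reciprocity hl i j
    rw [hf.rowmotionPow_add_natCast] at h
    rw [rho, rho, ← h]
    congr 1
    push_cast
    ring
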